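/- For $0<r<R<\infty$ let $A(r,R)=\{z\in\mathbb{C}\colon r<|z|<R\}$ and $C_\rho=\{z\in\mathbb{C}\colon |z|=\rho\}$, and write $M_\rho(f)=\frac1{2\pi}\int_0^{2\pi}f(\rho e^{i\theta})\,d\theta$ for the average of $f$ over $C_\rho$. Let $0<r<R<\infty$, $0<r_*<R_*<\infty$, and let $h\colon A(r,R)\to A(r_*,R_*)$ be an orientation preserving homeomorphism onto $A(r_*,R_*)$ which is (complex-valued) harmonic and preserves the order of the boundary circles; that is, the cluster set of $h$ at the inner circle $C_r$ (the set of all limits of sequences $h(z_n)$ with $z_n\in A(r,R)$, $|z_n|\to r$) is the inner circle $C_{r_*}$. Suppose that at least one of the following holds: (D) the average of $h$ on the inner circle vanishes, i.e. $\lim_{\rho\searrow r}M_\rho(h)=0$; (N) the normal derivative of $h$ has vanishing circle average, i.e. $M_\rho\left(\frac{\partial h}{\partial n}\right)=0$ for some $\rho\in(r,R)$, where $\frac{\partial h}{\partial n}$ is the radial derivative of $h$. Then, with no restriction on $R/r$, $$\frac{R_*}{r_*}\ge\frac12\left(\frac Rr+\frac rR\right).$$ -/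

import Mathlib

open Filter Topology Set

namespace Nitsche

/-- The open round annulus `A(r, R) = {z : r < |z| < R}`. -/
def annulus (r R : ℝ) : Set ℂ := {z | r < ‖z‖ ∧ ‖z‖ < R}

/-- The circle `C_ρ = {z : |z| = ρ}`. -/
def circle (ρ : ℝ) : Set ℂ := Metric.sphere (0 : ℂ) ρ

/-- `h` restricts to a homeomorphism of `U` onto `V`. -/
def IsHomeoOnto (h : ℂ → ℂ) (U V : Set ℂ) : Prop :=
  ∃ e : U ≃ₜ V, ∀ z : U, (e z : ℂ) = h z

/-- A homeomorphism `h` defined on `U` preserves orientation: for every closed disc in `U` of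
centre `z` and radius `ε > 0`, the image of the boundary circle, run through once in the positive
sense, has winding number `+1` about `h z`, i.e. the argument `φ` of `h (z + ε e^{iθ}) - h z`
has a continuous determination that grows by `2π` when `θ` does. -/
def IsOrientationPreservingOn (h : ℂ → ℂ) (U : Set ℂ) : Prop :=
  ∀ (z : ℂ) (ε : ℝ), 0 < ε → Metric.closedBall z ε ⊆ U →
    ∃ φ : ℝ → ℝ, Continuous φ ∧ (∀ θ, φ (θ + 2 * Real.pi) = φ θ + 2 * Real.pi) ∧
      ∀ θ : ℝ, h (circleMap z ε θ) - h z =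
        (‖h (circleMap z ε θ) - h z‖ : ℂ) * Complex.exp (φ θ * Complex.I)

/-- The cluster set at `C` of a map `h` defined on `U`: the limit points of `h z` as `z ∈ U`
approaches `C` (used for `C` a compact part of the boundary of `U`). -/
def clusterSet (h : ℂ → ℂ) (U C : Set ℂ) : Set ℂ :=
  {w | MapClusterPt w (𝓝ˢ C ⊓ 𝓟 U) h}

/-- The class `𝓗(A(r, R), A(r', R'))` of harmonic, orientation preserving homeomorphisms of
`A(r, R)` onto `A(r', R')` that preserve the order of the boundary circles: the cluster set at the
inner circle is the inner circle. -/
structure IsHarmonicHomeo (r R r' R' : ℝ) (h : ℂ → ℂ) : Prop where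
  harmonic : InnerProductSpace.HarmonicOnNhd h (annulus r R)
  homeo : IsHomeoOnto h (annulus r R) (annulus r' R')
  orientation : IsOrientationPreservingOn h (annulus r R)
  inner_boundary : clusterSet h (annulus r R) (circle r) = circle r'

/-- The normal (that is, radial) derivative `∂h/∂n` on the circles centred at `0`. -/
noncomputable def normalDeriv (h : ℂ → ℂ) (z : ℂ) : ℂ :=
  fderiv ℝ h z (z / (‖z‖ : ℂ))

/-- The class `𝓗_D`: the average over the inner circle vanishes. -/
def ClassD (r R r' R' : ℝ) : Set (ℂ → ℂ) :=
  {h | IsHarmonicHomeo r R r' R' h ∧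
    Tendsto (fun ρ : ℝ => Real.circleAverage h 0 ρ) (𝓝[>] r) (𝓝 0)}

/-- The class `𝓗_N`: the normal derivative has vanishing average over some circle `C_ρ`,
`r < ρ < R`. -/
def ClassN (r R r' R' : ℝ) : Set (ℂ → ℂ) :=
  {h | IsHarmonicHomeo r R r' R' h ∧
    ∃ ρ : ℝ, r < ρ ∧ ρ < R ∧ Real.circleAverage (normalDeriv h) 0 ρ = 0}

end Nitsche

namespace Nitsche

open Complex InnerProductSpace MeasureTheory

/-! Put `H ζ = h (exp ζ)`, a `2πi`-periodic harmonic map on the strip `log r < Re ζ < log R`. Let `U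
t` be the mean of `|H|²` on the line `Re ζ = t`, and `c n t` the Fourier coefficients of `H` there.
The Laplace equation gives `c'' = n² c`, so each mode with `n ≠ 0` is hyperbolic and the zero mode
is affine.

For `n ≠ 0`, `s < t` and `τ = t - s`, the mode inequality `norm_sq_lineCoeff_ge` bounds `|c n t|²`
below by `|c n s|² + n |c n s|² sinh² τ + 2 ⟨c n s, c' n s⟩ sinh τ cosh τ`. Summed with Parseval,
this bounds `U t` below by `U s + A s sinh² τ + U' s sinh τ cosh τ`, up to terms from the zero mode;
here `A s = ∑ n |c n s|²` is `1/π` times the signed area enclosed by the image of the line.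

Three geometric facts make this useful: `U s ≥ r'²`, since the image avoids the inner disc; `A s ≥
r'²`, by Stokes' formula with a radial cutoff and the nonnegative Jacobian
(`sq_le_lineAverage_dot_dIm`); and `U' s ≥ 0`, since `U` is convex and descends to its lower bound
`r'²` at the inner circle (`lineAverage_dot_dRe_nonneg`). Hence `U t ≥ r'² cosh² (t - s)` apart from
the zero mode, whose contribution is harmless under (N) for every `s`, and under (D) in the limit `s
→ log r`. Since `U ≤ R'²`, letting `s → log r` and `t → log R` gives `R' / r' ≥ cosh (log (R / r))`,
which is the claim. -/

/-! ### Harmonic maps of the plane and their partial derivatives. -/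

theorem harmonicAt_re {f : ℂ → ℂ} {z : ℂ} (hf : HarmonicAt f z) :
    HarmonicAt (fun w => (f w).re) z := hf.comp_CLM Complex.reCLM

theorem harmonicAt_im {f : ℂ → ℂ} {z : ℂ} (hf : HarmonicAt f z) :
    HarmonicAt (fun w => (f w).im) z := hf.comp_CLM Complex.imCLM

theorem analyticAt_of_harmonicAt {f : ℂ → ℂ} {z : ℂ} (hf : HarmonicAt f z) :
    AnalyticAt ℝ f z := by
  have h1 := (ofRealCLM.analyticAt _).comp (HarmonicAt.analyticAt (harmonicAt_re hf))
  have h2 := (ofRealCLM.analyticAt _).comp (HarmonicAt.analyticAt (harmonicAt_im hf))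
  have h3 := h1.add (h2.mul (analyticAt_const (v := I)))
  refine h3.congr (Eventually.of_forall fun w => ?_)
  simp

/-- On a small disc `f` is the real part of a holomorphic `F`, and `F ∘ g` is again holomorphic. -/
theorem harmonicAt_real_comp_analyticAt {f : ℂ → ℝ} {g : ℂ → ℂ} {z : ℂ}
    (hf : HarmonicAt f (g z)) (hg : AnalyticAt ℂ g z) : HarmonicAt (fun w => f (g w)) z := by
  obtain ⟨ε, hε, hs⟩ := Metric.isOpen_iff.1 (isOpen_setOfPred_harmonicAt (f := f)) _ hf
  obtain ⟨F, hF, hFf⟩ := HarmonicOnNhd.exists_analyticOnNhd_ball_re_eq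
    (f := f) (z := g z) (R := ε) (fun _ hy => hs hy)
  have h1 : AnalyticAt ℂ (F ∘ g) z := (hF _ (Metric.mem_ball_self hε)).comp hg
  refine (harmonicAt_congr_nhds ?_).1 h1.harmonicAt_re
  filter_upwards [hg.continuousAt.preimage_mem_nhds (Metric.ball_mem_nhds _ hε)] with w hw
  exact hFf hw

theorem harmonicAt_comp_analyticAt {f g : ℂ → ℂ} {z : ℂ}
    (hf : HarmonicAt f (g z)) (hg : AnalyticAt ℂ g z) : HarmonicAt (fun w => f (g w)) z := by
  have h1 := (harmonicAt_real_comp_analyticAt (harmonicAt_re hf) hg).comp_CLM ofRealCLM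
  have h2 := ((harmonicAt_real_comp_analyticAt (harmonicAt_im hf) hg).comp_CLM ofRealCLM).comp_CLM
    ((ContinuousLinearMap.mul ℝ ℂ) I)
  refine (harmonicAt_congr_nhds (Eventually.of_forall fun w => ?_)).1 (h1.add h2)
  simp [mul_comm I, re_add_im]

/-- The derivative in the direction of the real axis. -/
noncomputable def dRe (F : ℂ → ℂ) (z : ℂ) : ℂ := fderiv ℝ F z 1

/-- The derivative in the direction of the imaginary axis. -/
noncomputable def dIm (F : ℂ → ℂ) (z : ℂ) : ℂ := fderiv ℝ F z I

theorem analyticAt_dRe {F : ℂ → ℂ} {z : ℂ} (hF : AnalyticAt ℝ F z) : AnalyticAt ℝ (dRe F) z :=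
  ((ContinuousLinearMap.apply ℝ ℂ (1 : ℂ)).analyticAt _).comp hF.fderiv

theorem analyticAt_dIm {F : ℂ → ℂ} {z : ℂ} (hF : AnalyticAt ℝ F z) : AnalyticAt ℝ (dIm F) z :=
  ((ContinuousLinearMap.apply ℝ ℂ I).analyticAt _).comp hF.fderiv

theorem dRe_dIm_comm {F : ℂ → ℂ} {z : ℂ} (hF : AnalyticAt ℝ F z) :
    dRe (dIm F) z = dIm (dRe F) z := by
  have h2 := hF.fderiv.differentiableAt
  have h1 : dRe (dIm F) z = fderiv ℝ (fderiv ℝ F) z 1 I := by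
    simp [dRe, fderiv_clm_apply h2 (differentiableAt_const _),
      show dIm F = fun w => fderiv ℝ F w I from rfl]
  have h3 : dIm (dRe F) z = fderiv ℝ (fderiv ℝ F) z I 1 := by
    simp [dIm, fderiv_clm_apply h2 (differentiableAt_const _),
      show dRe F = fun w => fderiv ℝ F w 1 from rfl]
  rw [h1, h3]
  exact (hF.contDiffAt (n := 2)).isSymmSndFDerivAt (by simp) _ _

theorem dRe_dRe_add_dIm_dIm {F : ℂ → ℂ} {z : ℂ} (hF : HarmonicAt F z) :
    dRe (dRe F) z + dIm (dIm F) z = 0 := by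
  have hA := (analyticAt_of_harmonicAt hF).fderiv.differentiableAt
  have h := hF.2.eq_of_nhds
  rw [laplacian_eq_iteratedFDeriv_complexPlane] at h
  simp only [iteratedFDeriv_two_apply] at h
  simpa [dRe, dIm, fderiv_clm_apply hA (differentiableAt_const _),
      show dRe F = fun w => fderiv ℝ F w 1 from rfl,
      show dIm F = fun w => fderiv ℝ F w I from rfl] using h

theorem hasDerivAt_dRe {F : ℂ → ℂ} {t θ : ℝ} (hF : AnalyticAt ℝ F (t + θ * I)) :
    HasDerivAt (fun s : ℝ => F (s + θ * I)) (dRe F (t + θ * I)) t := by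
  have h1 : HasDerivAt (fun s : ℝ => (s : ℂ) + θ * I) 1 t :=
    (Complex.ofRealCLM.hasDerivAt).add_const _
  exact hF.differentiableAt.hasFDerivAt.comp_hasDerivAt t h1

theorem hasDerivAt_dIm {F : ℂ → ℂ} {t θ : ℝ} (hF : AnalyticAt ℝ F (t + θ * I)) :
    HasDerivAt (fun s : ℝ => F (t + s * I)) (dIm F (t + θ * I)) θ := by
  have h1 : HasDerivAt (fun s : ℝ => (t : ℂ) + s * I) I θ := by
    simpa using ((Complex.ofRealCLM.hasDerivAt (x := θ)).mul_const I).const_add (t : ℂ)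
  exact hF.differentiableAt.hasFDerivAt.comp_hasDerivAt θ h1

/-! ### Fourier coefficients on vertical lines. -/

/-- The vertical strip `a < Re z < b`. -/
def strip (a b : ℝ) : Set ℂ := {z | a < z.re ∧ z.re < b}

theorem mem_strip_add_mul_I {a b t : ℝ} (ht : t ∈ Ioo a b) (θ : ℝ) :
    (t + θ * I : ℂ) ∈ strip a b := by
  simpa [strip] using ht

theorem fderiv_periodic {F : ℂ → ℂ} (hF : Function.Periodic F (2 * Real.pi * I)) (z : ℂ) :
    fderiv ℝ F (z + 2 * Real.pi * I) = fderiv ℝ F z := by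
  rw [← fderiv_comp_add_right (𝕜 := ℝ) (f := F) (2 * Real.pi * I)]
  congr 1
  exact funext hF

theorem dRe_periodic {F : ℂ → ℂ} (hF : Function.Periodic F (2 * Real.pi * I)) :
    Function.Periodic (dRe F) (2 * Real.pi * I) := fun z => by
  rw [dRe, fderiv_periodic hF, dRe]

theorem dIm_periodic {F : ℂ → ℂ} (hF : Function.Periodic F (2 * Real.pi * I)) :
    Function.Periodic (dIm F) (2 * Real.pi * I) := fun z => by
  rw [dIm, fderiv_periodic hF, dIm]

/-- The `n`-th Fourier coefficient of `θ ↦ F (t + iθ)`. -/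
noncomputable def lineCoeff (F : ℂ → ℂ) (n : ℤ) (t : ℝ) : ℂ :=
  (2 * Real.pi)⁻¹ • ∫ θ in (0 : ℝ)..2 * Real.pi, exp (-(n * θ * I)) * F (t + θ * I)

/-- The average of `θ ↦ f (t + iθ)` over a period. -/
noncomputable def lineAverage (f : ℂ → ℝ) (t : ℝ) : ℝ :=
  (2 * Real.pi)⁻¹ * ∫ θ in (0 : ℝ)..2 * Real.pi, f (t + θ * I)

theorem lineCoeff_eq_fourierCoeffOn (F : ℂ → ℂ) (n : ℤ) (t : ℝ) :
    lineCoeff F n t = fourierCoeffOn Real.two_pi_pos (fun θ : ℝ => F (t + θ * I)) n := by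
  rw [fourierCoeffOn_eq_integral, lineCoeff]
  simp only [sub_zero, one_div]
  congr 1
  refine intervalIntegral.integral_congr fun θ _ => ?_
  simp only [fourier_coe_apply, smul_eq_mul]
  congr 2
  have : (Real.pi : ℂ) ≠ 0 := by exact_mod_cast Real.pi_ne_zero
  push_cast
  field_simp
  ring

theorem continuous_line {F : ℂ → ℂ} {a b t : ℝ} (hF : AnalyticOnNhd ℝ F (strip a b))
    (ht : t ∈ Ioo a b) : Continuous fun θ : ℝ => F (t + θ * I) :=
  hF.continuousOn.comp_continuous (by fun_prop) (mem_strip_add_mul_I ht)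

theorem hasDerivAt_lineCoeff {F : ℂ → ℂ} {a b t : ℝ} (hF : AnalyticOnNhd ℝ F (strip a b))
    (ht : t ∈ Ioo a b) (n : ℤ) :
    HasDerivAt (lineCoeff F n) (lineCoeff (dRe F) n t) t := by
  have hF' : AnalyticOnNhd ℝ (dRe F) (strip a b) := fun z hz => analyticAt_dRe (hF z hz)
  obtain ⟨δ, hδ, hball⟩ := Metric.nhds_basis_closedBall.mem_iff.1 (Ioo_mem_nhds ht.1 ht.2)
  have hK : IsCompact (Metric.closedBall t δ ×ˢ Icc 0 (2 * Real.pi)) :=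
    (isCompact_closedBall t δ).prod isCompact_Icc
  have hcont : ContinuousOn (fun p : ℝ × ℝ => exp (-(n * p.2 * I)) * dRe F (p.1 + p.2 * I))
      (Metric.closedBall t δ ×ˢ Icc 0 (2 * Real.pi)) := by
    refine ContinuousOn.mul (by fun_prop) (hF'.continuousOn.comp (by fun_prop) ?_)
    intro p hp
    exact mem_strip_add_mul_I (hball hp.1) _
  obtain ⟨C, hC⟩ := hK.exists_bound_of_continuousOn hcont
  have key := intervalIntegral.hasDerivAt_integral_of_dominated_loc_of_deriv_le (𝕜 := ℝ)
    (μ := volume) (a := 0) (b := 2 * Real.pi) (x₀ := t) (s := Metric.closedBall t δ)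
    (F := fun s θ => exp (-(n * θ * I)) * F (s + θ * I))
    (F' := fun s θ => exp (-(n * θ * I)) * dRe F (s + θ * I)) (bound := fun _ => C)
    (Metric.closedBall_mem_nhds t hδ) ?_ ?_ ?_ ?_ ?_ ?_
  · exact key.2.const_smul ((2 * Real.pi)⁻¹ : ℝ)
  · filter_upwards [Ioo_mem_nhds ht.1 ht.2] with s hs
    exact (Continuous.mul (by fun_prop) (continuous_line hF hs)).aestronglyMeasurable
  · exact (Continuous.mul (by fun_prop) (continuous_line hF ht)).intervalIntegrable _ _
  · exact (Continuous.mul (by fun_prop) (continuous_line hF' ht)).aestronglyMeasurable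
  · refine Eventually.of_forall fun θ hθ s hs => ?_
    rw [uIoc_of_le Real.two_pi_pos.le] at hθ
    exact hC (s, θ) ⟨hs, hθ.1.le, hθ.2⟩
  · exact intervalIntegrable_const
  · refine Eventually.of_forall fun θ _ s hs => ?_
    exact (hasDerivAt_dRe (hF _ (mem_strip_add_mul_I (hball hs) θ))).const_mul _

/-- Integration by parts in `θ`; periodicity cancels the boundary terms. -/
theorem lineCoeff_dIm {F : ℂ → ℂ} {a b t : ℝ} (hF : AnalyticOnNhd ℝ F (strip a b))
    (hper : Function.Periodic F (2 * Real.pi * I)) (ht : t ∈ Ioo a b) (n : ℤ) :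
    lineCoeff (dIm F) n t = n * I * lineCoeff F n t := by
  have hF' : AnalyticOnNhd ℝ (dIm F) (strip a b) := fun z hz => analyticAt_dIm (hF z hz)
  have hd : ∀ θ : ℝ, HasDerivAt (fun θ : ℝ => exp (-(n * θ * I)) * F (t + θ * I))
      (exp (-(n * θ * I)) * dIm F (t + θ * I)
        - n * I * (exp (-(n * θ * I)) * F (t + θ * I))) θ := by
    intro θ
    have h1 : HasDerivAt (fun θ : ℝ => exp (-(n * θ * I))) (exp (-(n * θ * I)) * (-(n * I))) θ := by
      have := (((Complex.ofRealCLM.hasDerivAt (x := θ)).const_mul (n : ℂ)).mul_const I).neg.cexp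
      simpa using this
    refine (h1.mul (hasDerivAt_dIm (hF _ (mem_strip_add_mul_I ht θ)))).congr_deriv ?_
    ring
  have hc1 : Continuous fun θ : ℝ => exp (-(n * θ * I)) * dIm F (t + θ * I) :=
    Continuous.mul (by fun_prop) (continuous_line hF' ht)
  have hc2 : Continuous fun θ : ℝ => n * I * (exp (-(n * θ * I)) * F (t + θ * I)) :=
    continuous_const.mul (Continuous.mul (by fun_prop) (continuous_line hF ht))
  have hint := intervalIntegral.integral_eq_sub_of_hasDerivAt (a := 0) (b := 2 * Real.pi)
    (fun θ _ => hd θ) ((hc1.sub hc2).intervalIntegrable _ _)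
  rw [intervalIntegral.integral_sub (hc1.intervalIntegrable _ _) (hc2.intervalIntegrable _ _),
    intervalIntegral.integral_const_mul] at hint
  have hend : exp (-(n * ((2 * Real.pi : ℝ) : ℂ) * I)) * F (t + ((2 * Real.pi : ℝ) : ℂ) * I)
      - exp (-(n * ((0 : ℝ) : ℂ) * I)) * F (t + ((0 : ℝ) : ℂ) * I) = 0 := by
    have h1 : exp (-(n * ((2 * Real.pi : ℝ) : ℂ) * I)) = 1 := by
      rw [exp_eq_one_iff]
      exact ⟨-n, by push_cast; ring⟩
    have h2 := hper (t : ℂ)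
    push_cast at h1 ⊢
    rw [h1, h2]
    simp
  rw [hend, sub_eq_zero] at hint
  rw [lineCoeff, lineCoeff, hint, mul_smul_comm]

theorem hasSum_norm_sq_lineCoeff {F : ℂ → ℂ} {t : ℝ}
    (hF : Continuous fun θ : ℝ => F (t + θ * I)) :
    HasSum (fun n => ‖lineCoeff F n t‖ ^ 2) (lineAverage (fun z => ‖F z‖ ^ 2) t) := by
  simp_rw [lineCoeff_eq_fourierCoeffOn]
  have := hasSum_sq_fourierCoeffOn Real.two_pi_pos (f := fun θ : ℝ => F (t + θ * I)) ?_
  · simpa [lineAverage] using this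
  · obtain ⟨C, hC⟩ := (isCompact_Icc (a := (0 : ℝ)) (b := 2 * Real.pi)).exists_bound_of_continuousOn
      hF.continuousOn
    refine MemLp.of_bound hF.aestronglyMeasurable C ?_
    filter_upwards [ae_restrict_mem measurableSet_Ioc] with θ hθ
    exact hC θ ⟨hθ.1.le, hθ.2⟩

theorem lineCoeff_add {F G : ℂ → ℂ} {t : ℝ} (hF : Continuous fun θ : ℝ => F (t + θ * I))
    (hG : Continuous fun θ : ℝ => G (t + θ * I)) (n : ℤ) :
    lineCoeff (fun z => F z + G z) n t = lineCoeff F n t + lineCoeff G n t := by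
  rw [lineCoeff, lineCoeff, lineCoeff, ← smul_add, ← intervalIntegral.integral_add]
  · simp only [mul_add]
  · exact (Continuous.mul (by fun_prop) hF).intervalIntegrable _ _
  · exact (Continuous.mul (by fun_prop) hG).intervalIntegrable _ _

theorem lineCoeff_const_mul (c : ℂ) (F : ℂ → ℂ) (n : ℤ) (t : ℝ) :
    lineCoeff (fun z => c * F z) n t = c * lineCoeff F n t := by
  rw [lineCoeff, lineCoeff, mul_smul_comm, ← intervalIntegral.integral_const_mul]
  simp only [mul_left_comm]

theorem lineAverage_add {f g : ℂ → ℝ} {t : ℝ} (hf : Continuous fun θ : ℝ => f (t + θ * I))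
    (hg : Continuous fun θ : ℝ => g (t + θ * I)) :
    lineAverage (fun z => f z + g z) t = lineAverage f t + lineAverage g t := by
  rw [lineAverage, intervalIntegral.integral_add (hf.intervalIntegrable _ _)
    (hg.intervalIntegrable _ _), mul_add, lineAverage, lineAverage]

theorem lineAverage_const_mul (c : ℝ) (f : ℂ → ℝ) (t : ℝ) :
    lineAverage (fun z => c * f z) t = c * lineAverage f t := by
  rw [lineAverage, intervalIntegral.integral_const_mul, lineAverage]
  ring

theorem norm_add_sq_re (x y : ℂ) :
    ‖x + y‖ ^ 2 = (‖x‖ ^ 2 + ‖y‖ ^ 2) + 2 * (x.re * y.re + x.im * y.im) := by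
  simp only [← Complex.normSq_eq_norm_sq, Complex.normSq_apply, add_re, add_im]
  ring

/-- Polarisation of Parseval's identity, applied to `F + G`, `F` and `G`. -/
theorem hasSum_inner_lineCoeff {F G : ℂ → ℂ} {t : ℝ}
    (hF : Continuous fun θ : ℝ => F (t + θ * I)) (hG : Continuous fun θ : ℝ => G (t + θ * I)) :
    HasSum (fun n => (lineCoeff F n t).re * (lineCoeff G n t).re
        + (lineCoeff F n t).im * (lineCoeff G n t).im)
      (lineAverage (fun z => (F z).re * (G z).re + (F z).im * (G z).im) t) := by
  have h1 := hasSum_norm_sq_lineCoeff (F := fun z => F z + G z) (hF.add hG)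
  have h2 := (h1.sub ((hasSum_norm_sq_lineCoeff hF).add (hasSum_norm_sq_lineCoeff hG))).mul_left
    (1 / 2)
  simp only [lineCoeff_add hF hG, norm_add_sq_re] at h2
  have hc1 : Continuous fun θ : ℝ => ‖F (t + θ * I)‖ ^ 2 := hF.norm.pow 2
  have hc2 : Continuous fun θ : ℝ => ‖G (t + θ * I)‖ ^ 2 := hG.norm.pow 2
  have hc3 : Continuous fun θ : ℝ => (F (t + θ * I)).re * (G (t + θ * I)).re
      + (F (t + θ * I)).im * (G (t + θ * I)).im :=
    ((continuous_re.comp hF).mul (continuous_re.comp hG)).add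
      ((continuous_im.comp hF).mul (continuous_im.comp hG))
  rw [lineAverage_add (f := fun z => ‖F z‖ ^ 2 + ‖G z‖ ^ 2)
      (g := fun z => 2 * ((F z).re * (G z).re + (F z).im * (G z).im))
      (hc1.add hc2) (continuous_const.mul hc3),
    lineAverage_add (f := fun z => ‖F z‖ ^ 2) (g := fun z => ‖G z‖ ^ 2) hc1 hc2,
    lineAverage_const_mul] at h2
  have hcancel : ∀ x y : ℝ, 1 / 2 * (x + 2 * y - x) = y := fun x y => by ring
  simpa only [hcancel] using h2

/-! ### Evolution of the modes of a harmonic map. -/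

/-- The Laplace equation replaces the second `t`-derivative by minus the second `θ`-derivative, and
each `θ`-derivative multiplies the coefficient by `n I`. -/
theorem hasDerivAt_lineCoeff_dRe {H : ℂ → ℂ} {a b t : ℝ} (hH : HarmonicOnNhd H (strip a b))
    (hper : Function.Periodic H (2 * Real.pi * I)) (ht : t ∈ Ioo a b) (n : ℤ) :
    HasDerivAt (lineCoeff (dRe H) n) (n ^ 2 * lineCoeff H n t) t := by
  have hA : AnalyticOnNhd ℝ H (strip a b) := fun z hz => analyticAt_of_harmonicAt (hH z hz)
  have hd := hasDerivAt_lineCoeff (F := dRe H) (fun z hz => analyticAt_dRe (hA z hz)) ht n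
  have h1 : lineCoeff (dRe (dRe H)) n t = lineCoeff (fun z => -1 * dIm (dIm H) z) n t := by
    rw [lineCoeff, lineCoeff]
    congr 1
    refine intervalIntegral.integral_congr fun θ _ => ?_
    rw [eq_neg_of_add_eq_zero_left (dRe_dRe_add_dIm_dIm (hH _ (mem_strip_add_mul_I ht θ))),
      neg_one_mul]
  rw [h1, lineCoeff_const_mul,
    lineCoeff_dIm (fun z hz => analyticAt_dIm (hA z hz)) (dIm_periodic hper) ht,
    lineCoeff_dIm hA hper ht] at hd
  refine hd.congr_deriv ?_
  linear_combination (-(n : ℂ) ^ 2 * lineCoeff H n t) * I_sq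

/-- A solution of `u' = k u` on an interval is an exponential. -/
theorem eq_exp_mul_of_hasDerivAt {u : ℝ → ℂ} {a b k : ℝ}
    (hu : ∀ t ∈ Ioo a b, HasDerivAt u (k * u t) t) {s t : ℝ} (hs : s ∈ Ioo a b)
    (ht : t ∈ Ioo a b) : u t = Real.exp (k * (t - s)) * u s := by
  have hd : ∀ x ∈ Ioo a b, HasDerivAt (fun x : ℝ => (Real.exp (-k * x) : ℂ) * u x) 0 x := by
    intro x hx
    have h1 : HasDerivAt (fun x : ℝ => (Real.exp (-k * x) : ℂ))
        ((Real.exp (-k * x) * -k : ℝ) : ℂ) x := by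
      have := (((hasDerivAt_id x).const_mul (-k)).exp).ofReal_comp
      simpa using this
    refine (h1.mul (hu x hx)).congr_deriv ?_
    push_cast
    ring
  have hconst := isOpen_Ioo.is_const_of_deriv_eq_zero isPreconnected_Ioo
    (fun x hx => (hd x hx).differentiableAt.differentiableWithinAt)
    (fun x hx => (hd x hx).deriv) hs ht
  have h2 : (Real.exp (k * (t - s)) : ℂ) = Real.exp (k * t) * Real.exp (-k * s) := by
    rw [← ofReal_mul, ← Real.exp_add]
    ring_nf
  rw [h2, mul_assoc, hconst, ← mul_assoc, ← ofReal_mul, ← Real.exp_add]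
  simp

/-- The combinations `c' + n c` and `c' - n c` solve first order equations, so they are
exponentials; half their difference is `n c`. Keeping the factor `n` avoids dividing by it. -/
theorem mul_lineCoeff_eq {H : ℂ → ℂ} {a b s t : ℝ} (hH : HarmonicOnNhd H (strip a b))
    (hper : Function.Periodic H (2 * Real.pi * I)) (hs : s ∈ Ioo a b) (ht : t ∈ Ioo a b) (n : ℤ) :
    n * lineCoeff H n t = n * Real.cosh (n * (t - s)) * lineCoeff H n s
      + Real.sinh (n * (t - s)) * lineCoeff (dRe H) n s := by
  have hA : AnalyticOnNhd ℝ H (strip a b) := fun z hz => analyticAt_of_harmonicAt (hH z hz)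
  have key : ∀ k : ℝ, k ^ 2 = n ^ 2 → lineCoeff (dRe H) n t + k * lineCoeff H n t =
      Real.exp (k * (t - s)) * (lineCoeff (dRe H) n s + k * lineCoeff H n s) := by
    intro k hk
    refine eq_exp_mul_of_hasDerivAt (u := fun x => lineCoeff (dRe H) n x + k * lineCoeff H n x)
      (fun x hx => ?_) hs ht
    refine ((hasDerivAt_lineCoeff_dRe hH hper hx n).add
      ((hasDerivAt_lineCoeff hA hx n).const_mul (k : ℂ))).congr_deriv ?_
    have hk' : (k : ℂ) ^ 2 = n ^ 2 := by exact_mod_cast hk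
    linear_combination (-lineCoeff H n x) * hk'
  have h1 := key n rfl
  have h2 := key (-n) (by ring)
  rw [Real.cosh_eq, Real.sinh_eq]
  rw [neg_mul] at h2
  push_cast at h1 h2 ⊢
  linear_combination (h1 - h2) / 2

theorem lineCoeff_zero_eq {H : ℂ → ℂ} {a b s t : ℝ} (hH : HarmonicOnNhd H (strip a b))
    (hper : Function.Periodic H (2 * Real.pi * I)) (hs : s ∈ Ioo a b) (ht : t ∈ Ioo a b) :
    lineCoeff (dRe H) 0 t = lineCoeff (dRe H) 0 s ∧
    lineCoeff H 0 t = lineCoeff H 0 s + (t - s) * lineCoeff (dRe H) 0 s := by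
  have hA : AnalyticOnNhd ℝ H (strip a b) := fun z hz => analyticAt_of_harmonicAt (hH z hz)
  have hd : ∀ x ∈ Ioo a b, HasDerivAt (lineCoeff (dRe H) 0) 0 x := fun x hx => by
    simpa using hasDerivAt_lineCoeff_dRe hH hper hx 0
  have hconst : ∀ x ∈ Ioo a b, lineCoeff (dRe H) 0 x = lineCoeff (dRe H) 0 s := fun x hx =>
    isOpen_Ioo.is_const_of_deriv_eq_zero isPreconnected_Ioo
      (fun x hx => (hd x hx).differentiableAt.differentiableWithinAt)
      (fun x hx => (hd x hx).deriv) hx hs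
  refine ⟨hconst t ht, ?_⟩
  have hd2 : ∀ x ∈ Ioo a b,
      HasDerivAt (fun x : ℝ => lineCoeff H 0 x - x * lineCoeff (dRe H) 0 s) 0 x := fun x hx => by
    refine ((hasDerivAt_lineCoeff hA hx 0).sub
      ((Complex.ofRealCLM.hasDerivAt (x := x)).mul_const (lineCoeff (dRe H) 0 s))).congr_deriv ?_
    simp [hconst x hx]
  have := isOpen_Ioo.is_const_of_deriv_eq_zero isPreconnected_Ioo
      (fun x hx => (hd2 x hx).differentiableAt.differentiableWithinAt)
      (fun x hx => (hd2 x hx).deriv) ht hs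
  linear_combination this

/-! ### Hyperbolic inequalities for a single mode. -/

/-- After rearrangement this is `N e^{-Nτ} sinh τ ≤ e^{-τ} sinh (N τ)`, that is, Bernoulli's
inequality for `(e^{2τ})^N`. -/
theorem natCast_mul_cosh_mul_sinh_le (N : ℕ) (τ : ℝ) :
    N * Real.cosh (N * τ) * Real.sinh τ
      ≤ Real.sinh (N * τ) * ((N - 1) * Real.sinh τ + Real.cosh τ) := by
  have hB := one_add_mul_le_pow (a := Real.exp (2 * τ) - 1)
    (by linarith [Real.exp_pos (2 * τ)]) N
  rw [add_sub_cancel, ← Real.exp_nat_mul] at hB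
  have e1 : Real.exp (N * (2 * τ)) = Real.exp (N * τ) * Real.exp (N * τ) := by
    rw [← Real.exp_add]; ring_nf
  have e2 : Real.exp (2 * τ) = Real.exp τ * Real.exp τ := by rw [← Real.exp_add]; ring_nf
  have e3 : Real.exp (N * τ) * Real.exp (-(N * τ)) = 1 := by rw [← Real.exp_add]; simp
  have e4 : Real.exp τ * Real.exp (-τ) = 1 := by rw [← Real.exp_add]; simp
  rw [e1, e2] at hB
  rw [Real.cosh_eq, Real.sinh_eq, Real.cosh_eq, Real.sinh_eq]
  have hm := mul_le_mul_of_nonneg_left hB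
    (mul_pos (Real.exp_pos (-(N * τ))) (Real.exp_pos (-τ))).le
  generalize Real.exp (N * τ) = P at *
  generalize Real.exp (-(N * τ)) = P' at *
  generalize Real.exp τ = p at *
  generalize Real.exp (-τ) = p' at *
  have h5 : P' * p' * (1 + N * (p * p - 1)) = P' * p' + N * (P' * p * (p * p') - P' * p') := by ring
  have h6 : P' * p' * (P * P) = P * p' * (P * P') := by ring
  rw [h5, h6, e3, e4] at hm
  nlinarith

/-- Supplies the sign that permits squaring an inequality in `sinh_mul_cosh_sub_sq_le`. -/
theorem sinh_nat_mul_le (N : ℕ) {τ : ℝ} (hτ : 0 ≤ τ) :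
    Real.sinh (N * τ) ≤ N * (Real.sinh τ * Real.cosh τ) * Real.cosh (N * τ) := by
  induction N with
  | zero => simp
  | succ N ih =>
    have hs := Real.sinh_nonneg_iff.2 hτ
    have hc := Real.one_le_cosh τ
    have hS : 0 ≤ Real.sinh (N * τ) := Real.sinh_nonneg_iff.2 (by positivity)
    have hC := Real.one_le_cosh (N * τ)
    push_cast
    rw [add_mul (N : ℝ) 1 τ, one_mul, Real.sinh_add, Real.cosh_add]
    have h1 := mul_le_mul_of_nonneg_right ih (zero_le_one.trans hc)
    have h2 : 0 ≤ Real.cosh (N * τ) * Real.sinh τ * (Real.cosh τ ^ 2 - 1) :=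
      mul_nonneg (by positivity) (by nlinarith)
    have h3 : 0 ≤ (N + 1) * (Real.sinh τ * Real.cosh τ) * (Real.sinh (N * τ) * Real.sinh τ) := by
      positivity
    nlinarith

/-- The inequality between hyperbolic functions behind the extremality of the first mode. -/
theorem sinh_mul_cosh_sub_sq_le {N : ℕ} (hN : 1 ≤ N) {τ : ℝ} (hτ : 0 < τ) :
    (Real.sinh (N * τ) * Real.cosh (N * τ) - N * (Real.sinh τ * Real.cosh τ)) ^ 2
      ≤ Real.sinh (N * τ) ^ 2 * (Real.sinh (N * τ) ^ 2 - N * Real.sinh τ ^ 2) := by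
  have h1 := natCast_mul_cosh_mul_sinh_le N τ
  have h2 := sinh_nat_mul_le N hτ.le
  have hs := Real.sinh_nonneg_iff.2 hτ.le
  have hc := Real.cosh_pos τ
  have hcs := Real.cosh_sq τ
  have hCS := Real.cosh_sq (N * τ)
  have hS : 0 ≤ Real.sinh (N * τ) := Real.sinh_nonneg_iff.2 (by positivity)
  have hN' : (1 : ℝ) ≤ N := by exact_mod_cast hN
  generalize Real.sinh (N * τ) = S at *
  generalize Real.cosh (N * τ) = C at *
  generalize Real.sinh τ = s at *
  generalize Real.cosh τ = c at *
  have h3 : N * (s * c) * C - S ≤ S * s * ((N - 1) * c + s) := by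
    have := mul_le_mul_of_nonneg_right h1 hc.le
    have e : S * ((N - 1) * s + c) * c = S * s * ((N - 1) * c + s) + S
        + S * (c ^ 2 - (s ^ 2 + 1)) := by
      ring
    rw [e, hcs] at this
    linarith
  have h4 := pow_le_pow_left₀ (sub_nonneg.2 h2) h3 2
  have h5 : 0 ≤ S ^ 2 * s ^ 2 * ((N - 1) * (c - s) ^ 2) := by
    have : 0 ≤ (N : ℝ) - 1 := by linarith
    positivity
  have hc2 : c ^ 2 = s ^ 2 + 1 := hcs
  -- Modulo `cosh² = sinh² + 1`, the defect is the difference of squares controlled by `h4` minus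
  -- the nonnegative quantity `h5`.
  have e1 : (S * C - N * (s * c)) ^ 2 - S ^ 2 * (S ^ 2 - N * s ^ 2)
      = (N * (s * c) * C - S) ^ 2 - (S * s * ((N - 1) * c + s)) ^ 2
        - S ^ 2 * s ^ 2 * ((N - 1) * (c - s) ^ 2) := by
    linear_combination (S ^ 2 - N ^ 2 * s ^ 2 * c ^ 2) * hCS
      - S ^ 2 * s ^ 2 * N * hc2
  linarith

/-- Here `x`, `y`, `β` stand for `|c|²`, `|c'/N|²` and their inner product. The difference of the
two sides is `x (S² - N s²) + y S² + 2 β M`, and `hkey` is exactly the discriminant condition making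
this form nonnegative. -/
theorem mode_nonneg {S C s c N x y β : ℝ} (hS : 0 < S) (hCS : C ^ 2 = S ^ 2 + 1)
    (hkey : (S * C - N * (s * c)) ^ 2 ≤ S ^ 2 * (S ^ 2 - N * s ^ 2)) (hx : 0 ≤ x) (hy : 0 ≤ y)
    (hβ : β ^ 2 ≤ x * y) :
    x * (1 + N * s ^ 2) + 2 * s * c * (N * β) ≤ x * C ^ 2 + y * S ^ 2 + 2 * S * C * β := by
  set M := S * C - N * (s * c) with hM
  have h1 : |2 * β * M * S ^ 2| ≤ x * M ^ 2 + y * (S ^ 2) ^ 2 := by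
    refine abs_le_of_sq_le_sq ?_ (by positivity)
    have h2 : 4 * M ^ 2 * (S ^ 2) ^ 2 * β ^ 2 ≤ 4 * M ^ 2 * (S ^ 2) ^ 2 * (x * y) :=
      mul_le_mul_of_nonneg_left hβ (by positivity)
    nlinarith [sq_nonneg (x * M ^ 2 - y * (S ^ 2) ^ 2)]
  have h3 := (abs_le.1 h1).1
  have h4 := mul_le_mul_of_nonneg_left hkey hx
  have h5 : 0 ≤ S ^ 2 * (x * (S ^ 2 - N * s ^ 2) + y * S ^ 2 + 2 * β * M) := by linarith
  have h6 := nonneg_of_mul_nonneg_right h5 (by positivity)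
  rw [hCS]
  rw [hM] at h6
  linarith

/-- The tangent-line inequality for the squared modulus of a mode, looking backwards. It reduces to
`0 ≤ sinh u cosh u - u ≤ sinh² u`, the upper bound coming from `1 - e^{-2u} ≤ 2u`. -/
theorem convex_mode_nonneg {u x y β : ℝ} (hu : 0 ≤ u) (hβ : |2 * β| ≤ x + y) :
    x - 2 * u * β ≤ x * Real.cosh u ^ 2 + y * Real.sinh u ^ 2
      - 2 * Real.sinh u * Real.cosh u * β := by
  have hS := Real.self_le_sinh_iff.2 hu
  have hC := Real.one_le_cosh u
  have h1 : Real.sinh u * Real.cosh u - u ≤ Real.sinh u ^ 2 := by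
    have h2 : Real.sinh u * (Real.cosh u - Real.sinh u) = (1 - Real.exp (-(2 * u))) / 2 := by
      rw [Real.cosh_sub_sinh, Real.sinh_eq, sub_div, sub_mul, div_mul_eq_mul_div, ← Real.exp_add,
        div_mul_eq_mul_div, ← Real.exp_add]
      ring_nf
      simp
    have h3 := Real.add_one_le_exp (-(2 * u))
    nlinarith
  have h4 : 0 ≤ Real.sinh u * Real.cosh u - u := by nlinarith
  have h5 : (Real.sinh u * Real.cosh u - u) * (2 * β) ≤ Real.sinh u ^ 2 * (x + y) :=
    (mul_le_mul_of_nonneg_left ((le_abs_self _).trans hβ) h4).trans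
      (mul_le_mul_of_nonneg_right h1 ((abs_nonneg _).trans hβ))
  rw [Real.cosh_sq]
  linarith

/-! ### Lower bounds for the mean square, mode by mode and summed. -/

/-- The real inner product of two complex numbers. -/
def dot (z w : ℂ) : ℝ := z.re * w.re + z.im * w.im

theorem norm_smul_add_smul_sq (p q : ℝ) (z w : ℂ) :
    ‖(p : ℂ) * z + q * w‖ ^ 2 = p ^ 2 * ‖z‖ ^ 2 + q ^ 2 * ‖w‖ ^ 2 + 2 * p * q * dot z w := by
  simp only [← Complex.normSq_eq_norm_sq, Complex.normSq_apply, add_re, add_im, re_ofReal_mul,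
    im_ofReal_mul, dot]
  ring

theorem dot_sq_le (z w : ℂ) : dot z w ^ 2 ≤ ‖z‖ ^ 2 * ‖w‖ ^ 2 := by
  simp only [← Complex.normSq_eq_norm_sq, Complex.normSq_apply, dot]
  nlinarith [sq_nonneg (z.re * w.im - z.im * w.re)]

theorem abs_two_mul_dot_le (z w : ℂ) : |2 * dot z w| ≤ ‖z‖ ^ 2 + ‖w‖ ^ 2 := by
  simp only [← Complex.normSq_eq_norm_sq, Complex.normSq_apply, dot]
  rw [abs_le]
  constructor <;> nlinarith [sq_nonneg (z.re - w.re), sq_nonneg (z.im - w.im),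
    sq_nonneg (z.re + w.re), sq_nonneg (z.im + w.im)]

theorem dot_mul_right (q : ℝ) (z w : ℂ) : dot z (q * w) = q * dot z w := by
  simp [dot]
  ring

/-- The `n`-th coefficient is determined by its value and derivative at a point, with
hyperbolic functions of nonnegative frequency. -/
theorem lineCoeff_eq_of_ne_zero {H : ℂ → ℂ} {a b s t : ℝ} (hH : HarmonicOnNhd H (strip a b))
    (hper : Function.Periodic H (2 * Real.pi * I)) (hs : s ∈ Ioo a b) (ht : t ∈ Ioo a b)
    {n : ℤ} (hn : n ≠ 0) :
    lineCoeff H n t = Real.cosh (n.natAbs * (t - s)) * lineCoeff H n s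
      + Real.sinh (n.natAbs * (t - s)) * (((n.natAbs : ℝ)⁻¹ : ℝ) * lineCoeff (dRe H) n s) := by
  have h := mul_lineCoeff_eq hH hper hs ht n
  have hn' : (n : ℂ) ≠ 0 := by exact_mod_cast hn
  obtain ⟨N, rfl | rfl⟩ := n.eq_nat_or_neg
  · rw [Int.natAbs_natCast]
    push_cast at h hn' ⊢
    field_simp
    linear_combination h
  · rw [Int.natAbs_neg, Int.natAbs_natCast]
    have e : ((-(N : ℤ) : ℤ) : ℝ) * (t - s) = -(N * (t - s)) := by push_cast; ring
    rw [e, Real.cosh_neg, Real.sinh_neg] at h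
    have hN : (N : ℂ) ≠ 0 := by simpa using hn'
    push_cast at h ⊢
    field_simp
    linear_combination -h

/-- The hyperbolic estimate holds with `|n|` in the middle term; lowering it to `n` produces the
`n`-th term of the series for the enclosed area. For `n = 1` equality holds when the derivative
coefficient vanishes at `s`. -/
theorem norm_sq_lineCoeff_ge {H : ℂ → ℂ} {a b s t : ℝ} (hH : HarmonicOnNhd H (strip a b))
    (hper : Function.Periodic H (2 * Real.pi * I)) (hs : s ∈ Ioo a b) (ht : t ∈ Ioo a b)
    (hst : s < t) {n : ℤ} (hn : n ≠ 0) :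
    ‖lineCoeff H n s‖ ^ 2 + Real.sinh (t - s) ^ 2 * (n * ‖lineCoeff H n s‖ ^ 2)
      + 2 * Real.sinh (t - s) * Real.cosh (t - s) * dot (lineCoeff H n s) (lineCoeff (dRe H) n s)
      ≤ ‖lineCoeff H n t‖ ^ 2 := by
  have hN : 1 ≤ n.natAbs := Int.natAbs_pos.2 hn
  have hN' : (0 : ℝ) < n.natAbs := by exact_mod_cast hN
  have hτ : 0 < t - s := sub_pos.2 hst
  rw [lineCoeff_eq_of_ne_zero hH hper hs ht hn, norm_smul_add_smul_sq]
  have h1 := mode_nonneg (Real.sinh_pos_iff.2 (mul_pos hN' hτ)) (Real.cosh_sq _)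
    (sinh_mul_cosh_sub_sq_le hN hτ) (sq_nonneg ‖lineCoeff H n s‖) (sq_nonneg _)
    (dot_sq_le (lineCoeff H n s) (((n.natAbs : ℝ)⁻¹ : ℝ) * lineCoeff (dRe H) n s))
  have h2 : (n.natAbs : ℝ) * dot (lineCoeff H n s) (((n.natAbs : ℝ)⁻¹ : ℝ) * lineCoeff (dRe H) n s)
      = dot (lineCoeff H n s) (lineCoeff (dRe H) n s) := by
    rw [dot_mul_right, mul_inv_cancel_left₀ hN'.ne']
  rw [h2] at h1
  have h3 : (n : ℝ) ≤ n.natAbs := by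
    rw [Nat.cast_natAbs]
    exact_mod_cast le_abs_self n
  have h4 : 0 ≤ ((n.natAbs : ℝ) - n) * (Real.sinh (t - s) ^ 2 * ‖lineCoeff H n s‖ ^ 2) :=
    mul_nonneg (sub_nonneg.2 h3) (by positivity)
  linarith

theorem norm_sq_lineCoeff_convex {H : ℂ → ℂ} {a b s t : ℝ} (hH : HarmonicOnNhd H (strip a b))
    (hper : Function.Periodic H (2 * Real.pi * I)) (hs : s ∈ Ioo a b) (ht : t ∈ Ioo a b)
    (hst : t < s) (n : ℤ) :
    ‖lineCoeff H n s‖ ^ 2 + 2 * (t - s) * dot (lineCoeff H n s) (lineCoeff (dRe H) n s)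
      ≤ ‖lineCoeff H n t‖ ^ 2 := by
  rcases eq_or_ne n 0 with rfl | hn
  · have h1 := norm_smul_add_smul_sq 1 (t - s) (lineCoeff H 0 s) (lineCoeff (dRe H) 0 s)
    rw [(lineCoeff_zero_eq hH hper hs ht).2]
    push_cast at h1
    rw [one_mul] at h1
    rw [h1]
    nlinarith [mul_nonneg (sq_nonneg (t - s)) (sq_nonneg ‖lineCoeff (dRe H) 0 s‖)]
  · have hN' : (0 : ℝ) < n.natAbs := by exact_mod_cast Int.natAbs_pos.2 hn
    rw [lineCoeff_eq_of_ne_zero hH hper hs ht hn, norm_smul_add_smul_sq]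
    have h1 := convex_mode_nonneg (u := n.natAbs * (s - t))
      (mul_nonneg hN'.le (sub_nonneg.2 hst.le))
      (abs_two_mul_dot_le (lineCoeff H n s) (((n.natAbs : ℝ)⁻¹ : ℝ) * lineCoeff (dRe H) n s))
    have h2 : (n.natAbs : ℝ)
        * dot (lineCoeff H n s) (((n.natAbs : ℝ)⁻¹ : ℝ) * lineCoeff (dRe H) n s)
        = dot (lineCoeff H n s) (lineCoeff (dRe H) n s) := by
      rw [dot_mul_right, mul_inv_cancel_left₀ hN'.ne']
    rw [← neg_sub s t]
    simp only [mul_neg, Real.cosh_neg, Real.sinh_neg]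
    rw [← h2]
    linarith

/-- The lower bound for the mean square on a line by data on another line. -/
theorem lineAverage_norm_sq_ge {H : ℂ → ℂ} {a b s t : ℝ} (hH : HarmonicOnNhd H (strip a b))
    (hper : Function.Periodic H (2 * Real.pi * I)) (hs : s ∈ Ioo a b) (ht : t ∈ Ioo a b)
    (hst : s < t) :
    lineAverage (fun z => ‖H z‖ ^ 2) s
      + Real.sinh (t - s) ^ 2 * lineAverage (fun z => dot (I * H z) (dIm H z)) s
      + 2 * Real.sinh (t - s) * Real.cosh (t - s) * (lineAverage (fun z => dot (H z) (dRe H z)) s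
        - dot (lineCoeff H 0 s) (lineCoeff (dRe H) 0 s)) - ‖lineCoeff H 0 s‖ ^ 2
      + ‖lineCoeff H 0 t‖ ^ 2
      ≤ lineAverage (fun z => ‖H z‖ ^ 2) t := by
  have hA : AnalyticOnNhd ℝ H (strip a b) := fun z hz => analyticAt_of_harmonicAt (hH z hz)
  have hcs := continuous_line hA hs
  have hcR := continuous_line (F := dRe H) (fun z hz => analyticAt_dRe (hA z hz)) hs
  have hcI := continuous_line (F := dIm H) (fun z hz => analyticAt_dIm (hA z hz)) hs
  have h1 := hasSum_norm_sq_lineCoeff hcs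
  have h2 := hasSum_inner_lineCoeff (F := fun z => I * H z) (continuous_const.mul hcs) hcI
  have h3 := hasSum_inner_lineCoeff hcs hcR
  have h4 := hasSum_norm_sq_lineCoeff (continuous_line hA ht)
  -- The mode inequality fails to cover `n = 0`; this one-term series corrects that term to an
  -- equality.
  have h0 := hasSum_ite_eq (0 : ℤ) (2 * Real.sinh (t - s) * Real.cosh (t - s) *
    dot (lineCoeff H 0 s) (lineCoeff (dRe H) 0 s) + ‖lineCoeff H 0 s‖ ^ 2 - ‖lineCoeff H 0 t‖ ^ 2)
  have h5 := ((h1.add (h2.mul_left (Real.sinh (t - s) ^ 2))).add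
    (h3.mul_left (2 * Real.sinh (t - s) * Real.cosh (t - s)))).sub h0
  have h6 := hasSum_le (fun n => ?_) h5 h4
  · simp only [dot] at h6 ⊢
    linarith
  · rcases eq_or_ne n 0 with rfl | hn
    · simp only [lineCoeff_const_mul, lineCoeff_dIm hA hper hs, dot, if_true]
      refine le_of_eq ?_
      simp only [Int.cast_zero, zero_mul, zero_re, zero_im, mul_zero, add_zero]
      ring
    · have h7 := norm_sq_lineCoeff_ge hH hper hs ht hst hn
      simp only [lineCoeff_const_mul, lineCoeff_dIm hA hper hs, if_neg hn, sub_zero]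
      refine le_trans (le_of_eq ?_) h7
      simp only [← Complex.normSq_eq_norm_sq, Complex.normSq_apply, dot, mul_re, mul_im, I_re,
        I_im, intCast_re,
        intCast_im]
      ring

/-- Sum over all modes of the tangent-line inequalities; twice the average of `dot (H z) (dRe H z)`
is the derivative of the mean square. -/
theorem lineAverage_norm_sq_convex {H : ℂ → ℂ} {a b s t : ℝ} (hH : HarmonicOnNhd H (strip a b))
    (hper : Function.Periodic H (2 * Real.pi * I)) (hs : s ∈ Ioo a b) (ht : t ∈ Ioo a b)
    (hst : t < s) :
    lineAverage (fun z => ‖H z‖ ^ 2) s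
      + 2 * (t - s) * lineAverage (fun z => dot (H z) (dRe H z)) s
      ≤ lineAverage (fun z => ‖H z‖ ^ 2) t := by
  have hA : AnalyticOnNhd ℝ H (strip a b) := fun z hz => analyticAt_of_harmonicAt (hH z hz)
  have hcs := continuous_line hA hs
  have hcR := continuous_line (F := dRe H) (fun z hz => analyticAt_dRe (hA z hz)) hs
  exact hasSum_le (fun n => norm_sq_lineCoeff_convex hH hper hs ht hst n)
    ((hasSum_norm_sq_lineCoeff hcs).add ((hasSum_inner_lineCoeff hcs hcR).mul_left _))
    (hasSum_norm_sq_lineCoeff (continuous_line hA ht))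

/-! ### Stokes' formula and the enclosed area. -/

theorem continuousOn_dot {X : Type*} [TopologicalSpace X] {F K : X → ℂ} {s : Set X}
    (hF : ContinuousOn F s) (hK : ContinuousOn K s) : ContinuousOn (fun x => dot (F x) (K x)) s :=
  ((continuous_re.comp_continuousOn hF).mul (continuous_re.comp_continuousOn hK)).add
    ((continuous_im.comp_continuousOn hF).mul (continuous_im.comp_continuousOn hK))

/-- The Jacobian determinant. -/
noncomputable def jac (H : ℂ → ℂ) (z : ℂ) : ℝ :=
  (dRe H z).re * (dIm H z).im - (dRe H z).im * (dIm H z).re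

theorem hasFDerivAt_dot {F K : ℂ → ℂ} {F' K' : ℂ →L[ℝ] ℂ} {z : ℂ} (hF : HasFDerivAt F F' z)
    (hK : HasFDerivAt K K' z) : ∃ L : ℂ →L[ℝ] ℝ, HasFDerivAt (fun w => dot (F w) (K w)) L z ∧
      ∀ v, L v = dot (F z) (K' v) + dot (F' v) (K z) := by
  have h1 := (reCLM.hasFDerivAt.comp z hF).mul (reCLM.hasFDerivAt.comp z hK)
  have h2 := (imCLM.hasFDerivAt.comp z hF).mul (imCLM.hasFDerivAt.comp z hK)
  refine ⟨_, h1.add h2, fun v => ?_⟩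
  simp [dot]
  ring

/-- The coefficient of the pullback of the form `G(|w|²) Im(conj w dw)` in a direction along which
the derivative is `K`. -/
noncomputable def areaForm (G : ℝ → ℝ) (H K : ℂ → ℂ) (z : ℂ) : ℝ :=
  G (dot (H z) (H z)) * dot (I * H z) (K z)

theorem hasFDerivAt_areaForm {G G' : ℝ → ℝ} (hG : ∀ u, HasDerivAt G (G' u) u) {H K : ℂ → ℂ} {z : ℂ}
    (hH : AnalyticAt ℝ H z) (hK : AnalyticAt ℝ K z) :
    ∃ L : ℂ →L[ℝ] ℝ, HasFDerivAt (areaForm G H K) L z ∧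
      ∀ v, L v = 2 * G' (dot (H z) (H z)) * dot (H z) (fderiv ℝ H z v) * dot (I * H z) (K z)
        + G (dot (H z) (H z)) * (dot (I * H z) (fderiv ℝ K z v)
          + dot (I * fderiv ℝ H z v) (K z)) := by
  have h1 := hH.differentiableAt.hasFDerivAt
  have h2 := hK.differentiableAt.hasFDerivAt
  obtain ⟨L1, hL1, e1⟩ := hasFDerivAt_dot h1 h1
  obtain ⟨L2, hL2, e2⟩ := hasFDerivAt_dot (h1.const_mul I) h2
  refine ⟨_, ((hG _).comp_hasFDerivAt z hL1).mul hL2, fun v => ?_⟩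
  simp [e1, e2]
  simp only [dot]
  ring

/-- In polar coordinates the form is `G(ρ²) ρ² dφ`, whose exterior derivative is `2 (G + u G')`
times the area form, with `u = ρ²`. In the pullback the mixed second derivatives of `H` cancel. -/
theorem fderiv_areaForm_sub {G G' : ℝ → ℝ} (hG : ∀ u, HasDerivAt G (G' u) u) {H : ℂ → ℂ} {z : ℂ}
    (hH : AnalyticAt ℝ H z) :
    fderiv ℝ (areaForm G H (dIm H)) z 1 - fderiv ℝ (areaForm G H (dRe H)) z I
      = 2 * (G (dot (H z) (H z)) + dot (H z) (H z) * G' (dot (H z) (H z))) * jac H z := by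
  obtain ⟨L1, h1, e1⟩ := hasFDerivAt_areaForm hG hH (analyticAt_dIm hH)
  obtain ⟨L2, h2, e2⟩ := hasFDerivAt_areaForm hG hH (analyticAt_dRe hH)
  rw [h1.fderiv, h2.fderiv, e1, e2]
  change 2 * G' _ * dot (H z) (dRe H z) * dot _ (dIm H z) + G _ * (dot _ (dRe (dIm H) z)
    + dot (I * dRe H z) (dIm H z)) - (2 * G' _ * dot (H z) (dIm H z) * dot _ (dRe H z) +
      G _ * (dot _ (dIm (dRe H) z) + dot (I * dIm H z) (dRe H z))) = _
  rw [dRe_dIm_comm hH, jac]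
  generalize G' (dot (H z) (H z)) = g
  generalize G (dot (H z) (H z)) = f
  simp only [dot, mul_re, mul_im, I_re, I_im]
  ring

theorem differentiableAt_areaForm {G G' : ℝ → ℝ} (hG : ∀ u, HasDerivAt G (G' u) u) {H K : ℂ → ℂ}
    {z : ℂ} (hH : AnalyticAt ℝ H z) (hK : AnalyticAt ℝ K z) :
    DifferentiableAt ℝ (areaForm G H K) z :=
  (hasFDerivAt_areaForm hG hH hK).choose_spec.1.differentiableAt

theorem setIntegral_reProdIm (f : ℂ → ℝ) (s t : Set ℝ) :
    ∫ z in s ×ℂ t, f z = ∫ p in s ×ˢ t, f (p.1 + p.2 * I) := by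
  have h := (Complex.volume_preserving_equiv_real_prod.symm).setIntegral_preimage_emb
    Complex.measurableEquivRealProd.symm.measurableEmbedding f (s ×ℂ t)
  rw [← h]
  have e : Complex.measurableEquivRealProd.symm ⁻¹' (s ×ℂ t) = s ×ˢ t := by
    ext p
    simp [Complex.mem_reProdIm, Complex.measurableEquivRealProd]
  rw [e]
  congr 1
  funext p
  rw [← Complex.mk_eq_add_mul_I]
  rfl

theorem setIntegral_Ioc_prod_eq (f : ℝ × ℝ → ℝ) (a b c d : ℝ) :
    ∫ p in Ioc a b ×ˢ Ioc c d, f p = ∫ p in Icc (a, c) (b, d), f p := by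
  rw [← Icc_prod_Icc]
  refine setIntegral_congr_set ?_
  rw [Measure.volume_eq_prod]
  exact Measure.set_prod_ae_eq Ioc_ae_eq_Icc Ioc_ae_eq_Icc

/-- Stokes' formula for the pullback of `G(|w|²) Im(conj w dw)` on a period rectangle. -/
theorem setIntegral_jac_eq {G G' : ℝ → ℝ} (hG : ∀ u, HasDerivAt G (G' u) u)
    (hG' : Continuous G') {H : ℂ → ℂ} {a b s t : ℝ} (hA : AnalyticOnNhd ℝ H (strip a b))
    (hper : Function.Periodic H (2 * Real.pi * I)) (hs : s ∈ Ioo a b) (ht : t ∈ Ioo a b)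
    (hst : s ≤ t) :
    ∫ z in Ioc s t ×ℂ Ioc 0 (2 * Real.pi),
      2 * (G (dot (H z) (H z)) + dot (H z) (H z) * G' (dot (H z) (H z))) * jac H z
      = 2 * Real.pi * (lineAverage (areaForm G H (dIm H)) t
        - lineAverage (areaForm G H (dIm H)) s) := by
  have hAR : AnalyticOnNhd ℝ (dRe H) (strip a b) := fun z hz => analyticAt_dRe (hA z hz)
  have hAI : AnalyticOnNhd ℝ (dIm H) (strip a b) := fun z hz => analyticAt_dIm (hA z hz)
  set e : ℝ × ℝ →L[ℝ] ℂ := Complex.equivRealProdCLM.symm.toContinuousLinearMap with he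
  have he' : ∀ p, e p = p.1 + p.2 * I := fun p => by
    rw [← Complex.mk_eq_add_mul_I]; rfl
  have he1 : e (1, 0) = 1 := by rw [he']; simp
  have he2 : e (0, 1) = I := by rw [he']; simp
  have hmem : ∀ p ∈ Icc (s, (0 : ℝ)) (t, 2 * Real.pi), e p ∈ strip a b := fun p hp => by
    rw [he']
    exact mem_strip_add_mul_I ⟨hs.1.trans_le hp.1.1, hp.2.1.trans_lt ht.2⟩ _
  have hd : ∀ K : ℂ → ℂ, AnalyticOnNhd ℝ K (strip a b) →
      ∀ p ∈ Icc (s, (0 : ℝ)) (t, 2 * Real.pi), HasFDerivAt (fun p => areaForm G H K (e p))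
        ((fderiv ℝ (areaForm G H K) (e p)).comp e) p := fun K hK p hp =>
    (differentiableAt_areaForm hG (hA _ (hmem p hp))
      (hK _ (hmem p hp))).hasFDerivAt.comp p e.hasFDerivAt
  have hsub : Ioo s t ×ˢ Ioo 0 (2 * Real.pi) ⊆ Icc (s, (0 : ℝ)) (t, 2 * Real.pi) := by
    rw [← Icc_prod_Icc]
    exact prod_mono Ioo_subset_Icc_self Ioo_subset_Icc_self
  have hform : ∀ p ∈ Icc (s, (0 : ℝ)) (t, 2 * Real.pi),
      ((fderiv ℝ (areaForm G H (dIm H)) (e p)).comp e) (1, 0)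
        + (-((fderiv ℝ (areaForm G H (dRe H)) (e p)).comp e)) (0, 1)
      = 2 * (G (dot (H (e p)) (H (e p))) + dot (H (e p)) (H (e p)) * G' (dot (H (e p)) (H (e p))))
        * jac H (e p) := fun p hp => by
    rw [← fderiv_areaForm_sub hG (hA _ (hmem p hp))]
    simp [he1, he2, sub_eq_add_neg]
  have hcont : ContinuousOn (fun p : ℝ × ℝ => 2 * (G (dot (H (e p)) (H (e p)))
      + dot (H (e p)) (H (e p)) * G' (dot (H (e p)) (H (e p)))) * jac H (e p))
      (Icc (s, (0 : ℝ)) (t, 2 * Real.pi)) := by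
    have hGc : Continuous G := continuous_iff_continuousAt.2 fun u => (hG u).continuousAt
    have c1 : ContinuousOn (fun p => H (e p)) (Icc (s, (0 : ℝ)) (t, 2 * Real.pi)) :=
      hA.continuousOn.comp e.continuous.continuousOn hmem
    have c2 : ContinuousOn (fun p => dRe H (e p)) (Icc (s, (0 : ℝ)) (t, 2 * Real.pi)) :=
      hAR.continuousOn.comp e.continuous.continuousOn hmem
    have c3 : ContinuousOn (fun p => dIm H (e p)) (Icc (s, (0 : ℝ)) (t, 2 * Real.pi)) :=
      hAI.continuousOn.comp e.continuous.continuousOn hmem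
    have c4 : ContinuousOn (fun p => dot (H (e p)) (H (e p)))
        (Icc (s, (0 : ℝ)) (t, 2 * Real.pi)) := continuousOn_dot c1 c1
    have c5 : ContinuousOn (fun p => jac H (e p)) (Icc (s, (0 : ℝ)) (t, 2 * Real.pi)) :=
      ((continuous_re.comp_continuousOn c2).mul (continuous_im.comp_continuousOn c3)).sub
        ((continuous_im.comp_continuousOn c2).mul (continuous_re.comp_continuousOn c3))
    exact (continuousOn_const.mul ((hGc.comp_continuousOn c4).add
      (c4.mul (hG'.comp_continuousOn c4)))).mul c5
  have hdiv := integral_divergence_prod_Icc_of_hasFDerivAt_of_le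
    (fun p => areaForm G H (dIm H) (e p)) (fun p => -areaForm G H (dRe H) (e p))
    (fun p => (fderiv ℝ (areaForm G H (dIm H)) (e p)).comp e)
    (fun p => -((fderiv ℝ (areaForm G H (dRe H)) (e p)).comp e))
    (s, 0) (t, 2 * Real.pi) ⟨hst, Real.two_pi_pos.le⟩
    (fun p hp => (hd _ hAI p hp).continuousAt.continuousWithinAt)
    (fun p hp => (hd _ hAR p hp).continuousAt.continuousWithinAt.neg)
    (fun p hp => hd _ hAI p (hsub hp)) (fun p hp => (hd _ hAR p (hsub hp)).neg)
    ((hcont.congr hform).integrableOn_compact isCompact_Icc)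
  rw [setIntegral_congr_fun measurableSet_Icc hform] at hdiv
  rw [setIntegral_reProdIm, setIntegral_Ioc_prod_eq]
  simp only [he'] at hdiv
  rw [hdiv]
  -- By periodicity the two horizontal sides of the rectangle cancel.
  have hperR : ∀ x : ℝ, areaForm G H (dRe H) (x + ((2 * Real.pi : ℝ) : ℂ) * I)
      = areaForm G H (dRe H) (x + ((0 : ℝ) : ℂ) * I) := fun x => by
    have h1 := hper (x : ℂ)
    have h2 := dRe_periodic hper (x : ℂ)
    unfold areaForm
    push_cast
    rw [h1, h2]
    simp
  simp only [hperR, sub_self, zero_add, lineAverage]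
  rw [← mul_sub, mul_inv_cancel_left₀ Real.two_pi_pos.ne']

theorem dot_self (z : ℂ) : dot z z = ‖z‖ ^ 2 := by
  rw [← Complex.normSq_eq_norm_sq, Complex.normSq_apply, dot]

theorem det_fderiv (H : ℂ → ℂ) (z : ℂ) : (fderiv ℝ H z).det = jac H z := by
  rw [ContinuousLinearMap.det, ← LinearMap.det_toMatrix Complex.basisOneI, Matrix.det_fin_two]
  simp [LinearMap.toMatrix_apply, jac, dRe, dIm]
  ring

theorem measurableSet_reProdIm_Ioc (s t c d : ℝ) : MeasurableSet (Ioc s t ×ℂ Ioc c d) :=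
  (measurable_re measurableSet_Ioc).inter (measurable_im measurableSet_Ioc)

theorem reProdIm_subset_strip {a b s t c d : ℝ} (hs : s ∈ Ioo a b) (ht : t ∈ Ioo a b) :
    Icc s t ×ℂ Icc c d ⊆ strip a b := fun _ hz =>
  ⟨hs.1.trans_le hz.1.1, hz.1.2.trans_lt ht.2⟩

/-- The integral of a radial density over the image of a period rectangle. -/
theorem setIntegral_image_eq {G G' : ℝ → ℝ} (hG : ∀ u, HasDerivAt G (G' u) u)
    (hG' : Continuous G') {H : ℂ → ℂ} {a b s t : ℝ} (hA : AnalyticOnNhd ℝ H (strip a b))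
    (hper : Function.Periodic H (2 * Real.pi * I)) (hs : s ∈ Ioo a b) (ht : t ∈ Ioo a b)
    (hst : s ≤ t) (hinj : InjOn H (Ioc s t ×ℂ Ioc 0 (2 * Real.pi)))
    (hjac : ∀ z ∈ strip a b, 0 ≤ jac H z) :
    ∫ w in H '' (Ioc s t ×ℂ Ioc 0 (2 * Real.pi)), 2 * (G (dot w w) + dot w w * G' (dot w w))
      = 2 * Real.pi * (lineAverage (areaForm G H (dIm H)) t
        - lineAverage (areaForm G H (dIm H)) s) := by
  have hsub : Ioc s t ×ℂ Ioc 0 (2 * Real.pi) ⊆ strip a b :=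
    (inter_subset_inter (preimage_mono Ioc_subset_Icc_self)
      (preimage_mono Ioc_subset_Icc_self)).trans (reProdIm_subset_strip hs ht)
  rw [integral_image_eq_integral_abs_det_fderiv_smul volume
    (measurableSet_reProdIm_Ioc s t 0 (2 * Real.pi))
    (fun z hz => (hA z (hsub hz)).differentiableAt.hasFDerivAt.hasFDerivWithinAt) hinj,
    ← setIntegral_jac_eq hG hG' hA hper hs ht hst]
  refine setIntegral_congr_fun (measurableSet_reProdIm_Ioc s t 0 (2 * Real.pi)) fun z hz => ?_
  simp only [det_fderiv, abs_of_nonneg (hjac z (hsub hz)), smul_eq_mul]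
  ring

theorem analyticAt_cexp_real (z : ℂ) : AnalyticAt ℝ exp z :=
  (analyticAt_cexp (z := z)).restrictScalars

theorem fderiv_cexp_apply (z v : ℂ) : fderiv ℝ exp z v = v * exp z := by
  rw [((hasDerivAt_exp z).hasFDerivAt.restrictScalars ℝ).fderiv]
  simp

theorem jac_cexp (z : ℂ) : jac exp z = ‖exp z‖ ^ 2 := by
  simp only [jac, dRe, dIm, fderiv_cexp_apply, ← dot_self, dot]
  simp

theorem lineAverage_areaForm_cexp (G : ℝ → ℝ) (t : ℝ) :
    lineAverage (areaForm G exp (dIm exp)) t = G (Real.exp t ^ 2) * Real.exp t ^ 2 := by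
  have h : ∀ θ : ℝ, areaForm G exp (dIm exp) (t + θ * I) = G (Real.exp t ^ 2) * Real.exp t ^ 2 := by
    intro θ
    rw [areaForm, dIm, fderiv_cexp_apply, dot_self, dot_self, norm_mul, norm_I, one_mul, norm_exp]
    simp
  simp only [lineAverage, h, intervalIntegral.integral_const, smul_eq_mul, sub_zero]
  rw [inv_mul_cancel_left₀ Real.two_pi_pos.ne']

theorem injOn_cexp_reProdIm (s t : ℝ) : InjOn exp (Ioc s t ×ℂ Ioc 0 (2 * Real.pi)) := by
  intro z hz w hw h
  obtain ⟨n, hn⟩ := exp_eq_exp_iff_exists_int.1 h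
  have h1 : z.im = w.im + n * (2 * Real.pi) := by simpa using congrArg im hn
  have hz2 : z.im ∈ Ioc 0 (2 * Real.pi) := hz.2
  have hw2 : w.im ∈ Ioc 0 (2 * Real.pi) := hw.2
  have h2 : n = 0 := by
    have hpi := Real.two_pi_pos
    have h3 : (n : ℝ) < 1 := by
      by_contra! hc
      nlinarith [hz2.2, hw2.1]
    have h4 : (-1 : ℝ) < n := by
      by_contra! hc
      nlinarith [hz2.1, hw2.2]
    have h3' : n < 1 := by exact_mod_cast h3
    have h4' : -1 < n := by exact_mod_cast h4
    omega
  rw [hn, h2]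
  simp

theorem cexp_periodic : Function.Periodic exp (2 * Real.pi * I) := exp_periodic

/-- The area enclosed by the image of a vertical line is at least that of a disc around which the
image of a period rectangle closes up. -/
theorem le_lineAverage_dot_dIm {H : ℂ → ℂ} {a b s t c d : ℝ} (hA : AnalyticOnNhd ℝ H (strip a b))
    (hper : Function.Periodic H (2 * Real.pi * I)) (hs : s ∈ Ioo a b) (ht : t ∈ Ioo a b)
    (hst : s ≤ t) (hinj : InjOn H (Ioc s t ×ℂ Ioc 0 (2 * Real.pi)))
    (hjac : ∀ z ∈ strip a b, 0 ≤ jac H z) (hc : 0 < c) (hcd : c < d)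
    (hHs : ∀ θ : ℝ, ‖H (s + θ * I)‖ ^ 2 ≤ c) (hHt : ∀ θ : ℝ, d ≤ ‖H (t + θ * I)‖ ^ 2)
    (hsub : ∀ w : ℂ, c < ‖w‖ ^ 2 → ‖w‖ ^ 2 ≤ d → w ∈ H '' (Ioc s t ×ℂ Ioc 0 (2 * Real.pi))) :
    d ≤ lineAverage (fun z => dot (I * H z) (dIm H z)) t := by
  -- This cutoff vanishes up to `c` and equals `1` from `d` on, so it kills the inner boundary term
  -- and leaves the unweighted area integral on the outer line.
  set G : ℝ → ℝ := fun u => Real.smoothTransition ((u - c) / (d - c)) with hGdef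
  have hdc : 0 < d - c := sub_pos.2 hcd
  have hGsm : ContDiff ℝ 1 G := Real.smoothTransition.contDiff.comp (by fun_prop)
  have hG : ∀ u, HasDerivAt G (deriv G u) u := fun u =>
    (hGsm.differentiable one_ne_zero u).hasDerivAt
  have hG' : Continuous (deriv G) := hGsm.continuous_deriv le_rfl
  have hGmono : Monotone G := fun u v huv =>
    Real.smoothTransition.monotone (div_le_div_of_nonneg_right (by linarith) hdc.le)
  have hG0 : ∀ u ≤ c, G u = 0 := fun u hu =>
    Real.smoothTransition.zero_of_nonpos (div_nonpos_of_nonpos_of_nonneg (by linarith) hdc.le)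
  have hG1 : ∀ u, d ≤ u → G u = 1 := fun u hu =>
    Real.smoothTransition.one_of_one_le ((one_le_div hdc).2 (by linarith))
  have hφ : ∀ w : ℂ, 0 ≤ 2 * (G (dot w w) + dot w w * deriv G (dot w w)) := fun w => by
    have h1 : 0 ≤ G (dot w w) := Real.smoothTransition.nonneg _
    have h2 : 0 ≤ deriv G (dot w w) := hGmono.deriv_nonneg
    have h3 : 0 ≤ dot w w := by rw [dot_self]; positivity
    positivity
  have hφc : Continuous fun w : ℂ => 2 * (G (dot w w) + dot w w * deriv G (dot w w)) := by
    have h1 : Continuous fun w : ℂ => dot w w := by simp only [dot_self]; fun_prop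
    exact continuous_const.mul ((hGsm.continuous.comp h1).add (h1.mul (hG'.comp h1)))
  have hclose : Ioc s t ×ℂ Ioc 0 (2 * Real.pi) ⊆ Icc s t ×ℂ Icc 0 (2 * Real.pi) :=
    inter_subset_inter (preimage_mono Ioc_subset_Icc_self) (preimage_mono Ioc_subset_Icc_self)
  have hcomp : IsCompact (H '' (Icc s t ×ℂ Icc 0 (2 * Real.pi))) :=
    (isCompact_Icc.reProdIm isCompact_Icc).image_of_continuousOn
      (hA.continuousOn.mono (reProdIm_subset_strip hs ht))
  have hint : IntegrableOn (fun w : ℂ => 2 * (G (dot w w) + dot w w * deriv G (dot w w)))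
      (H '' (Ioc s t ×ℂ Ioc 0 (2 * Real.pi))) :=
    (hφc.continuousOn.integrableOn_compact hcomp).mono_set (image_mono hclose)
  have hd : 0 < d := hc.trans hcd
  -- With these abscissae `exp` maps a period rectangle onto the annulus `c < |w|² ≤ d`; the same
  -- formula applied to `exp` evaluates the comparison integral.
  set p := Real.log c / 2 with hp
  set q := Real.log d / 2 with hq
  have hpq : p ≤ q := div_le_div_of_nonneg_right (Real.log_le_log hc hcd.le) zero_le_two
  have hep : Real.exp p ^ 2 = c := by
    rw [← Real.exp_nat_mul, hp]
    push_cast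
    rw [mul_div_cancel₀ _ two_ne_zero, Real.exp_log hc]
  have heq : Real.exp q ^ 2 = d := by
    rw [← Real.exp_nat_mul, hq]
    push_cast
    rw [mul_div_cancel₀ _ two_ne_zero, Real.exp_log hd]
  have hsub' : exp '' (Ioc p q ×ℂ Ioc 0 (2 * Real.pi)) ⊆ H '' (Ioc s t ×ℂ Ioc 0 (2 * Real.pi)) := by
    rintro w ⟨z, hz, rfl⟩
    refine hsub _ ?_ ?_
    · rw [norm_exp, ← hep]
      exact pow_lt_pow_left₀ (Real.exp_lt_exp.2 hz.1.1) (Real.exp_pos _).le two_ne_zero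
    · rw [norm_exp, ← heq]
      exact pow_le_pow_left₀ (Real.exp_pos _).le (Real.exp_le_exp.2 hz.1.2) 2
  have hmono := setIntegral_mono_set hint (ae_of_all _ hφ) (LE.le.eventuallyLE hsub')
  rw [setIntegral_image_eq hG hG' hA hper hs ht hst hinj hjac,
    setIntegral_image_eq hG hG' (a := p - 1) (b := q + 1) (fun z _ => analyticAt_cexp_real z)
      cexp_periodic ⟨by linarith, by linarith⟩ ⟨by linarith, by linarith⟩ hpq
      (injOn_cexp_reProdIm p q) (fun z _ => by rw [jac_cexp]; positivity),
    lineAverage_areaForm_cexp, lineAverage_areaForm_cexp, hep, heq, hG0 c le_rfl, hG1 d le_rfl]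
    at hmono
  have e1 : lineAverage (areaForm G H (dIm H)) t
      = lineAverage (fun z => dot (I * H z) (dIm H z)) t := by
    simp only [lineAverage, areaForm, dot_self, hG1 _ (hHt _), one_mul]
  have e2 : lineAverage (areaForm G H (dIm H)) s = 0 := by
    simp [lineAverage, areaForm, dot_self, hG0 _ (hHs _)]
  rw [e1, e2] at hmono
  have := le_of_mul_le_mul_left hmono Real.two_pi_pos
  linarith

/-! ### Orientation and the sign of the Jacobian. -/

theorem jac_comp {f g : ℂ → ℂ} {z : ℂ} (hf : DifferentiableAt ℝ f (g z))
    (hg : DifferentiableAt ℝ g z) : jac (fun w => f (g w)) z = jac f (g z) * jac g z := by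
  rw [← det_fderiv, ← det_fderiv, ← det_fderiv, fderiv_fun_comp z hf hg]
  exact LinearMap.det_comp _ _

/-- The Wirtinger decomposition of a real linear map. -/
theorem clm_apply_eq_wirtinger (L : ℂ →L[ℝ] ℂ) (ζ : ℂ) :
    L ζ = (L 1 - I * L I) / 2 * ζ + (L 1 + I * L I) / 2 * (starRingEnd ℂ) ζ := by
  have h1 : L ζ = ζ.re * L 1 + ζ.im * L I := by
    conv_lhs => rw [(by simp : ζ = ζ.re • (1 : ℂ) + ζ.im • I)]
    rw [map_add, map_smul, map_smul, real_smul, real_smul]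
  have h2 : (starRingEnd ℂ) ζ = ζ.re - ζ.im * I := by
    apply Complex.ext <;> simp
  rw [h1, h2]
  have h3 : ζ = ζ.re + ζ.im * I := (re_add_im ζ).symm
  generalize ζ.re = x at *
  generalize ζ.im = y at *
  rw [h3]
  linear_combination (y * L I) * I_sq

theorem jac_eq_wirtinger (H : ℂ → ℂ) (z : ℂ) :
    jac H z = ‖(dRe H z - I * dIm H z) / 2‖ ^ 2 - ‖(dRe H z + I * dIm H z) / 2‖ ^ 2 := by
  simp only [← Complex.normSq_eq_norm_sq, Complex.normSq_apply, jac]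
  simp
  ring

/-- If the Jacobian were negative, the antiholomorphic part `B` of the derivative would dominate. On
a small circle the increment of `h` would then stay within a right angle of `B e^{-iθ}`, whereas its
argument gains `2π` by orientation. -/
theorem jac_nonneg_of_isOrientationPreservingOn {h : ℂ → ℂ} {U : Set ℂ} (hU : IsOpen U)
    (hor : IsOrientationPreservingOn h U) {z : ℂ} (hz : z ∈ U) (hd : DifferentiableAt ℝ h z) :
    0 ≤ jac h z := by
  by_contra! hneg
  set A := (dRe h z - I * dIm h z) / 2 with hA
  set B := (dRe h z + I * dIm h z) / 2 with hB
  have hAB : ‖A‖ < ‖B‖ := by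
    rw [jac_eq_wirtinger] at hneg
    exact lt_of_pow_lt_pow_left₀ 2 (norm_nonneg _) (by linarith)
  have hBpos : 0 < ‖B‖ := (norm_nonneg _).trans_lt hAB
  have hκ : 0 < (‖B‖ - ‖A‖) / 2 := half_pos (sub_pos.2 hAB)
  have hlit := hd.hasFDerivAt.isLittleO.bound hκ
  obtain ⟨ε, hε, hball⟩ := Metric.nhds_basis_closedBall.mem_iff.1
    (Filter.inter_mem hlit (hU.mem_nhds hz))
  obtain ⟨φ, hφc, hφ2, hφ⟩ := hor z ε hε (hball.trans inter_subset_right)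
  have hcos : ∀ θ : ℝ, 0 < Real.cos (φ θ + θ - arg B) := by
    intro θ
    have hmem : circleMap z ε θ ∈ Metric.closedBall z ε :=
      Metric.sphere_subset_closedBall (circleMap_mem_sphere z hε.le θ)
    have h1 : ‖h (circleMap z ε θ) - h z - fderiv ℝ h z (circleMap z ε θ - z)‖
        ≤ (‖B‖ - ‖A‖) / 2 * ‖circleMap z ε θ - z‖ := (hball hmem).1
    have h2 : circleMap z ε θ - z = ε * exp (θ * I) := by simp [circleMap]
    have h3 : (starRingEnd ℂ) ((ε : ℂ) * exp (θ * I)) = ε * exp (-(θ * I)) := by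
      rw [map_mul, conj_ofReal, ← exp_conj]
      simp
    have h4 : ‖(ε : ℂ) * exp (θ * I)‖ = ε := by
      rw [norm_mul, norm_exp_ofReal_mul_I, mul_one, norm_real, Real.norm_of_nonneg hε.le]
    rw [h2, h4, clm_apply_eq_wirtinger, h3] at h1
    change ‖_ - (A * _ + B * _)‖ ≤ _ at h1
    set D := h (circleMap z ε θ) - h z with hD
    set E := D - (A * (ε * exp (θ * I)) + B * (ε * exp (-(θ * I)))) with hE
    have hee : exp (θ * I) * exp (-(θ * I)) = 1 := by rw [← exp_add]; simp
    have hBB : B * (starRingEnd ℂ) B = ((‖B‖ ^ 2 : ℝ) : ℂ) := by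
      rw [mul_conj, normSq_eq_norm_sq]
    have h5 : D * exp (θ * I) * (starRingEnd ℂ) B = (ε * ‖B‖ ^ 2 : ℝ)
        + (E + A * (ε * exp (θ * I))) * exp (θ * I) * (starRingEnd ℂ) B := by
      rw [hE]
      push_cast at hBB ⊢
      linear_combination (B * ε * (starRingEnd ℂ) B) * hee + ε * hBB
    have h6 : ‖(E + A * (ε * exp (θ * I))) * exp (θ * I) * (starRingEnd ℂ) B‖
        ≤ ((‖B‖ - ‖A‖) / 2 * ε + ‖A‖ * ε) * ‖B‖ := by
      rw [norm_mul, norm_mul, norm_exp_ofReal_mul_I, mul_one, RCLike.norm_conj]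
      refine mul_le_mul_of_nonneg_right ((norm_add_le _ _).trans (add_le_add h1 ?_)) hBpos.le
      rw [norm_mul, h4]
    have h7 : 0 < (D * exp (θ * I) * (starRingEnd ℂ) B).re := by
      rw [h5, add_re, ofReal_re]
      have h8 := (abs_le.1 ((abs_re_le_norm _).trans h6)).1
      have h9 : 0 < ε * ‖B‖ * ((‖B‖ - ‖A‖) / 2) := by positivity
      linarith
    have hBe : (starRingEnd ℂ) B = ‖B‖ * exp (-(arg B * I)) := by
      conv_lhs => rw [← norm_mul_exp_arg_mul_I B]
      rw [map_mul, conj_ofReal, ← exp_conj]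
      simp
    have h10 : D * exp (θ * I) * (starRingEnd ℂ) B
        = ((‖D‖ * ‖B‖ : ℝ) : ℂ) * exp ((φ θ + θ - arg B : ℝ) * I) := by
      have hφθ : D = ‖D‖ * exp (φ θ * I) := hφ θ
      rw [hBe]
      conv_lhs => rw [hφθ]
      push_cast
      rw [sub_mul, add_mul, sub_eq_add_neg, exp_add, exp_add]
      ring
    rw [h10, re_ofReal_mul, exp_ofReal_mul_I_re] at h7
    exact pos_of_mul_pos_right h7 (by positivity)
  set ψ : ℝ → ℝ := fun θ => φ θ + θ - arg B with hψ
  have hψc : Continuous ψ := by fun_prop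
  have hψ2 : ψ (2 * Real.pi) = ψ 0 + 4 * Real.pi := by
    have := hφ2 0
    rw [zero_add] at this
    simp only [hψ, this]
    ring
  -- The angle `ψ` gains `2π` from `φ` and `2π` from `θ`, so it passes `ψ 0 + π`, where the cosine
  -- has the opposite sign.
  obtain ⟨θ, -, hθ⟩ := intermediate_value_Icc Real.two_pi_pos.le hψc.continuousOn
    (show ψ 0 + Real.pi ∈ Icc (ψ 0) (ψ (2 * Real.pi)) from
      ⟨by linarith [Real.pi_pos], by rw [hψ2]; linarith [Real.pi_pos]⟩)
  have h1 := hcos θ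
  have h2 := hcos 0
  change 0 < Real.cos (ψ θ) at h1
  change 0 < Real.cos (ψ 0) at h2
  rw [hθ, Real.cos_add_pi] at h1
  linarith

/-! ### Annuli and behaviour at the inner circle. -/

theorem isOpen_annulus (r R : ℝ) : IsOpen (annulus r R) :=
  (isOpen_lt continuous_const continuous_norm).inter (isOpen_lt continuous_norm continuous_const)

theorem cexp_mem_annulus {r R : ℝ} (hr : 0 < r) (hR : 0 < R) {z : ℂ} :
    exp z ∈ annulus r R ↔ z ∈ strip (Real.log r) (Real.log R) := by
  simp only [annulus, strip, mem_ofPred_eq, norm_exp, Real.log_lt_iff_lt_exp hr,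
    Real.lt_log_iff_exp_lt hR]

theorem isPreconnected_annulus {r R : ℝ} (hr : 0 ≤ r) : IsPreconnected (annulus r R) := by
  have h1 : annulus r R = (fun p : ℝ × ℝ => (p.1 : ℂ) * exp (p.2 * I)) '' (Ioo r R ×ˢ univ) := by
    ext z
    constructor
    · intro hz
      exact ⟨(‖z‖, arg z), ⟨hz, mem_univ _⟩, norm_mul_exp_arg_mul_I z⟩
    · rintro ⟨p, ⟨hp, -⟩, rfl⟩
      have h2 : ‖(p.1 : ℂ) * exp (p.2 * I)‖ = p.1 := by
        rw [norm_mul, norm_exp_ofReal_mul_I, mul_one, norm_real,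
          Real.norm_of_nonneg (hr.trans hp.1.le)]
      rw [annulus, mem_ofPred_eq, h2]
      exact hp
  rw [h1]
  exact (isPreconnected_Ioo.prod isPreconnected_univ).image _ (by fun_prop)

/-- Near the inner circle the modulus of `h` is close to the radius of its image. -/
theorem exists_norm_lt_of_clusterSet {h : ℂ → ℂ} {r R r' R' q : ℝ} (hr : 0 < r)
    (hmaps : ∀ z ∈ annulus r R, ‖h z‖ ≤ R')
    (hcl : clusterSet h (annulus r R) (circle r) = circle r') (hq : r' < q) :
    ∃ δ > 0, ∀ z ∈ annulus r R, ‖z‖ < r + δ → ‖h z‖ < q := by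
  have hev : ∀ᶠ z in 𝓝ˢ (circle r) ⊓ 𝓟 (annulus r R), ‖h z‖ < q := by
    by_contra hcon
    rw [not_eventually] at hcon
    simp only [not_lt] at hcon
    -- Otherwise compactness yields a cluster value of modulus at least `q`, off the circle of
    -- radius `r'`.
    set F := (𝓝ˢ (circle r) ⊓ 𝓟 (annulus r R)) ⊓ 𝓟 {z | q ≤ ‖h z‖} with hF
    have hne : NeBot F := frequently_mem_iff_neBot.1 hcon
    have hK : IsCompact (Metric.closedBall (0 : ℂ) R' ∩ {w | q ≤ ‖w‖}) :=
      (isCompact_closedBall 0 R').inter_right (isClosed_le continuous_const continuous_norm)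
    have hle : map h F ≤ 𝓟 (Metric.closedBall (0 : ℂ) R' ∩ {w | q ≤ ‖w‖}) := by
      rw [le_principal_iff, mem_map]
      have h1 : annulus r R ∈ F := mem_inf_of_left (mem_inf_of_right (mem_principal_self _))
      have h2 : {z | q ≤ ‖h z‖} ∈ F := mem_inf_of_right (mem_principal_self _)
      filter_upwards [h1, h2] with z hz1 hz2
      exact ⟨mem_closedBall_zero_iff.2 (hmaps z hz1), hz2⟩
    obtain ⟨w, hw, hwc⟩ := hK hle
    have hwm : w ∈ clusterSet h (annulus r R) (circle r) :=
      ClusterPt.mono hwc (map_mono inf_le_left)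
    rw [hcl] at hwm
    have := mem_sphere_zero_iff_norm.1 hwm
    have hw2 : q ≤ ‖w‖ := hw.2
    linarith
  obtain ⟨δ, hδ, hsub⟩ := (Metric.hasBasis_nhdsSet_thickening
    (isCompact_sphere (0 : ℂ) r)).mem_iff.1 (mem_inf_principal.1 hev)
  refine ⟨δ, hδ, fun z hz hzδ => hsub ?_ hz⟩
  have hz0 : 0 < ‖z‖ := hr.trans hz.1
  refine Metric.mem_thickening_iff.2 ⟨((r / ‖z‖ : ℝ) : ℂ) * z, ?_, ?_⟩
  · rw [mem_sphere_zero_iff_norm, norm_mul, norm_real, Real.norm_of_nonneg (by positivity),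
      div_mul_cancel₀ _ hz0.ne']
  · rw [dist_eq_norm]
    have : z - ((r / ‖z‖ : ℝ) : ℂ) * z = ((1 - r / ‖z‖ : ℝ) : ℂ) * z := by push_cast; ring
    have h1 : r / ‖z‖ ≤ 1 := (div_le_one hz0).2 hz.1.le
    rw [this, norm_mul, norm_real, Real.norm_of_nonneg (by linarith), sub_mul,
      div_mul_cancel₀ _ hz0.ne']
    linarith

/-- Points of small modulus in the target come from inside a given circle. -/
theorem norm_lt_of_norm_map_lt {h : ℂ → ℂ} {r R r' R' ρ m : ℝ}
    (hhom : IsHomeoOnto h (annulus r R) (annulus r' R')) (hr' : 0 ≤ r')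
    (hm : ∀ z ∈ annulus r R, ‖z‖ = ρ → m ≤ ‖h z‖) (hmR : m ≤ R')
    {z₀ : ℂ} (hz₀ : z₀ ∈ annulus r R) (hz₀ρ : ‖z₀‖ < ρ) (hhz₀ : ‖h z₀‖ < m)
    {z : ℂ} (hz : z ∈ annulus r R) (hhz : ‖h z‖ < m) : ‖z‖ < ρ := by
  obtain ⟨e, he⟩ := hhom
  -- The preimage of `r' < |w| < m` is connected and avoids the circle of radius `ρ`, so it stays on
  -- the side of `z₀`.
  have h1 : IsPreconnected (Subtype.val ⁻¹' annulus r' m : Set (annulus r' R')) := by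
    rw [← Topology.IsInducing.subtypeVal.isPreconnected_image, Subtype.image_preimage_coe,
      inter_eq_right.2 (show annulus r' m ⊆ annulus r' R' from
        fun w hw => ⟨hw.1, hw.2.trans_le hmR⟩)]
    exact isPreconnected_annulus hr'
  have h2 := (h1.image e.symm e.symm.continuous.continuousOn).image
    (fun z : annulus r R => ‖(z : ℂ)‖) (by fun_prop)
  have hin : ∀ w (hw : w ∈ annulus r R), ‖h w‖ < m →
      ‖w‖ ∈ (fun z : annulus r R => ‖(z : ℂ)‖) ''
        (e.symm '' (Subtype.val ⁻¹' annulus r' m : Set (annulus r' R'))) := by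
    intro w hw hwm
    refine ⟨⟨w, hw⟩, ⟨e ⟨w, hw⟩, ?_, e.symm_apply_apply _⟩, rfl⟩
    refine ⟨(e ⟨w, hw⟩).2.1, ?_⟩
    rw [he]
    exact hwm
  by_contra! hcon
  obtain ⟨v, ⟨w, hw, rfl⟩, hv⟩ := h2.ordConnected.out (hin z₀ hz₀ hhz₀) (hin z hz hhz)
    ⟨hz₀ρ.le, hcon⟩
  have h3 := hm _ (e.symm w).2 hv
  rw [← he, e.apply_symm_apply] at h3
  exact absurd hw.2 (not_lt.2 h3)

/-! ### Averages over lines and over circles. -/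

theorem lineAverage_le {f : ℂ → ℝ} {t c : ℝ} (hf : Continuous fun θ : ℝ => f (t + θ * I))
    (hc : ∀ θ : ℝ, f (t + θ * I) ≤ c) : lineAverage f t ≤ c := by
  have h1 := intervalIntegral.integral_mono_on Real.two_pi_pos.le
    (hf.intervalIntegrable (μ := volume) _ _)
    (intervalIntegrable_const (c := c)) fun θ _ => hc θ
  rw [intervalIntegral.integral_const, sub_zero, smul_eq_mul] at h1
  rw [lineAverage, inv_mul_le_iff₀ Real.two_pi_pos]
  exact h1

theorem le_lineAverage {f : ℂ → ℝ} {t c : ℝ} (hf : Continuous fun θ : ℝ => f (t + θ * I))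
    (hc : ∀ θ : ℝ, c ≤ f (t + θ * I)) : c ≤ lineAverage f t := by
  have h1 := intervalIntegral.integral_mono_on Real.two_pi_pos.le
    (intervalIntegrable_const (c := c)) (hf.intervalIntegrable (μ := volume) _ _) fun θ _ => hc θ
  rw [intervalIntegral.integral_const, sub_zero, smul_eq_mul] at h1
  rw [lineAverage, le_inv_mul_iff₀ Real.two_pi_pos]
  exact h1

theorem circleMap_zero_exp (t θ : ℝ) : circleMap 0 (Real.exp t) θ = exp (t + θ * I) := by
  simp [circleMap, exp_add]

theorem lineCoeff_zero_eq_circleAverage (h : ℂ → ℂ) (t : ℝ) :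
    lineCoeff (fun w => h (exp w)) 0 t = Real.circleAverage h 0 (Real.exp t) := by
  simp [lineCoeff, Real.circleAverage, circleMap_zero_exp]

/-- The `t`-derivative of `h (exp (t + iθ))` is the radius times the radial derivative of `h`. -/
theorem lineCoeff_zero_dRe_eq_circleAverage {h : ℂ → ℂ} {a b t : ℝ} (ht : t ∈ Ioo a b)
    (hd : ∀ z ∈ strip a b, DifferentiableAt ℝ h (exp z)) :
    lineCoeff (dRe fun w => h (exp w)) 0 t
      = Real.exp t * Real.circleAverage (normalDeriv h) 0 (Real.exp t) := by
  rw [lineCoeff, Real.circleAverage, mul_smul_comm, ← intervalIntegral.integral_const_mul]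
  congr 1
  refine intervalIntegral.integral_congr fun θ _ => ?_
  have h1 : ‖exp (t + θ * I)‖ = Real.exp t := by simp [norm_exp]
  have h2 : exp (t + θ * I) = Real.exp t • (exp (t + θ * I) / (‖exp (t + θ * I)‖ : ℂ)) := by
    rw [h1, real_smul, mul_div_cancel₀]
    exact_mod_cast (Real.exp_pos t).ne'
  have h3 : dRe (fun w => h (exp w)) (t + θ * I)
      = fderiv ℝ h (exp (t + θ * I)) (exp (t + θ * I)) := by
    rw [dRe, fderiv_fun_comp _ (hd _ (mem_strip_add_mul_I ht θ))
      (analyticAt_cexp_real _).differentiableAt, ContinuousLinearMap.comp_apply,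
      fderiv_cexp_apply, one_mul]
  simp only [Int.cast_zero, zero_mul, neg_zero, exp_zero, one_mul, circleMap_zero_exp, normalDeriv]
  rw [h3]
  conv_lhs => rw [h2]
  rw [map_smul, real_smul, ← h2]

/-! ### Geometric bounds for the homeomorphism and the conclusion. -/

namespace IsHarmonicHomeo

variable {r R r' R' : ℝ} {h : ℂ → ℂ}

theorem map_mem (hh : IsHarmonicHomeo r R r' R' h) {z : ℂ} (hz : z ∈ annulus r R) :
    h z ∈ annulus r' R' := by
  obtain ⟨e, he⟩ := hh.homeo
  rw [← he ⟨z, hz⟩]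
  exact (e ⟨z, hz⟩).2

theorem injOn (hh : IsHarmonicHomeo r R r' R' h) : InjOn h (annulus r R) := by
  obtain ⟨e, he⟩ := hh.homeo
  intro z hz w hw hzw
  have h1 : e ⟨z, hz⟩ = e ⟨w, hw⟩ := Subtype.ext (by rw [he, he]; exact hzw)
  exact congrArg Subtype.val (e.injective h1)

theorem exists_eq (hh : IsHarmonicHomeo r R r' R' h) {w : ℂ} (hw : w ∈ annulus r' R') :
    ∃ z ∈ annulus r R, h z = w := by
  obtain ⟨e, he⟩ := hh.homeo
  refine ⟨e.symm ⟨w, hw⟩, (e.symm ⟨w, hw⟩).2, ?_⟩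
  rw [← he, e.apply_symm_apply]

theorem harmonicOnNhd_comp_exp (hh : IsHarmonicHomeo r R r' R' h) (hr : 0 < r) (hR : 0 < R) :
    HarmonicOnNhd (fun w => h (exp w)) (strip (Real.log r) (Real.log R)) := fun _ hz =>
  harmonicAt_comp_analyticAt (hh.harmonic _ ((cexp_mem_annulus hr hR).2 hz)) analyticAt_cexp

theorem periodic_comp_exp (h : ℂ → ℂ) :
    Function.Periodic (fun w => h (exp w)) (2 * Real.pi * I) := fun z => by
  simp only [cexp_periodic z]

theorem jac_comp_exp_nonneg (hh : IsHarmonicHomeo r R r' R' h) (hr : 0 < r) (hR : 0 < R) {z : ℂ}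
    (hz : z ∈ strip (Real.log r) (Real.log R)) : 0 ≤ jac (fun w => h (exp w)) z := by
  have hm := (cexp_mem_annulus hr hR).2 hz
  have hd := (analyticAt_of_harmonicAt (hh.harmonic _ hm)).differentiableAt
  rw [jac_comp hd (analyticAt_cexp_real z).differentiableAt, jac_cexp]
  exact mul_nonneg (jac_nonneg_of_isOrientationPreservingOn (isOpen_annulus r R) hh.orientation
    hm hd) (by positivity)

theorem exists_norm_lt (hh : IsHarmonicHomeo r R r' R' h) (hr : 0 < r) {q : ℝ} (hq : r' < q) :
    ∃ δ > 0, ∀ z ∈ annulus r R, ‖z‖ < r + δ → ‖h z‖ < q :=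
  exists_norm_lt_of_clusterSet hr (fun _ hz => (hh.map_mem hz).2.le) hh.inner_boundary hq

/-- The mean area enclosed by the image of a circle is at least that of the inner disc. -/
theorem sq_le_lineAverage_dot_dIm (hh : IsHarmonicHomeo r R r' R' h) (hr : 0 < r) (hR : 0 < R)
    (hr' : 0 < r') {t : ℝ} (ht : t ∈ Ioo (Real.log r) (Real.log R)) :
    r' ^ 2 ≤ lineAverage (fun z => dot (I * h (exp z)) (dIm (fun w => h (exp w)) z)) t := by
  set ρ := Real.exp t with hρ
  have hrρ : r < ρ := (Real.log_lt_iff_lt_exp hr).1 ht.1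
  have hρR : ρ < R := (Real.lt_log_iff_exp_lt hR).1 ht.2
  have hsph : Metric.sphere (0 : ℂ) ρ ⊆ annulus r R := fun z hz => by
    rw [mem_sphere_zero_iff_norm] at hz
    exact ⟨by rw [hz]; exact hrρ, by rw [hz]; exact hρR⟩
  have hρmem : ∀ x : ℝ, 0 < x → ‖(x : ℂ)‖ = x := fun x hx => by
    rw [norm_real, Real.norm_of_nonneg hx.le]
  -- With `m` the least modulus on the image of the circle, take `r' < q < p < m` and a circle of
  -- radius `σ` so near the inner one that its image lies in `|w| < q`. The region between the two
  -- circles then covers `q < |w| ≤ p`.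
  obtain ⟨z₁, hz₁, hmin⟩ := (isCompact_sphere (0 : ℂ) ρ).exists_isMinOn
    ⟨(ρ : ℂ), mem_sphere_zero_iff_norm.2 (hρmem ρ (hr.trans hrρ))⟩
    ((hh.harmonic.continuousOn.mono hsph).norm)
  set m := ‖h z₁‖ with hm
  have hm1 : r' < m := (hh.map_mem (hsph hz₁)).1
  have hmR : m ≤ R' := (hh.map_mem (hsph hz₁)).2.le
  obtain ⟨q, hrq, hqm⟩ := exists_between hm1
  obtain ⟨p, hqp, hpm⟩ := exists_between hqm
  have hq0 : 0 < q := hr'.trans hrq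
  have hp0 : 0 < p := hq0.trans hqp
  obtain ⟨δ, hδ, hδq⟩ := hh.exists_norm_lt hr hrq
  obtain ⟨σ, hσ1, hσ2⟩ := exists_between (lt_min hrρ (lt_add_of_pos_right r hδ))
  have hσρ := hσ2.trans_le (min_le_left _ _)
  have hσδ := hσ2.trans_le (min_le_right _ _)
  have hσ0 : 0 < σ := hr.trans hσ1
  have hσt : Real.log σ < t := (Real.log_lt_iff_lt_exp hσ0).2 hσρ
  have hs : Real.log σ ∈ Ioo (Real.log r) (Real.log R) :=
    ⟨Real.log_lt_log hr hσ1, hσt.trans ht.2⟩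
  have hA : AnalyticOnNhd ℝ (fun w => h (exp w)) (strip (Real.log r) (Real.log R)) :=
    fun z hz => analyticAt_of_harmonicAt (hh.harmonicOnNhd_comp_exp hr hR z hz)
  have hnorm : ∀ x θ : ℝ, ‖exp (x + θ * I)‖ = Real.exp x := fun x θ => by simp [norm_exp]
  have hrect : Ioc (Real.log σ) t ×ℂ Ioc 0 (2 * Real.pi) ⊆ strip (Real.log r) (Real.log R) :=
    fun z hz => ⟨hs.1.trans hz.1.1, hz.1.2.trans_lt ht.2⟩
  have hσA : (σ : ℂ) ∈ annulus r R := by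
    rw [annulus, mem_ofPred_eq, hρmem σ hσ0]
    exact ⟨hσ1, hσρ.trans hρR⟩
  have key := le_lineAverage_dot_dIm (c := q ^ 2) (d := p ^ 2) hA (periodic_comp_exp h) hs ht hσt.le
    ?_ (fun z hz => hh.jac_comp_exp_nonneg hr hR hz) (pow_pos hq0 2)
    (pow_lt_pow_left₀ hqp hq0.le two_ne_zero) ?_ ?_ ?_
  · exact (pow_le_pow_left₀ hr'.le (hrq.trans hqp).le 2).trans key
  · intro z hz w hw hzw
    exact injOn_cexp_reProdIm _ _ hz hw (hh.injOn ((cexp_mem_annulus hr hR).2 (hrect hz))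
      ((cexp_mem_annulus hr hR).2 (hrect hw)) hzw)
  · intro θ
    refine pow_le_pow_left₀ (norm_nonneg _) (hδq _ ?_ ?_).le 2
    · exact (cexp_mem_annulus hr hR).2 (mem_strip_add_mul_I hs θ)
    · rw [hnorm, Real.exp_log hσ0]
      exact hσδ
  · intro θ
    refine pow_le_pow_left₀ hp0.le (hpm.le.trans ?_) 2
    exact hmin (mem_sphere_zero_iff_norm.2 (hnorm t θ))
  · intro w hw1 hw2
    have hqw : q < ‖w‖ := lt_of_pow_lt_pow_left₀ 2 (norm_nonneg _) hw1
    have hwp : ‖w‖ ≤ p := le_of_sq_le_sq hw2 hp0.le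
    obtain ⟨z, hz, hzw⟩ := hh.exists_eq (w := w)
      ⟨hrq.trans hqw, hwp.trans_lt (hpm.trans_le hmR)⟩
    have hz0 : 0 < ‖z‖ := hr.trans hz.1
    have hzρ : ‖z‖ < ρ := norm_lt_of_norm_map_lt hh.homeo hr'.le
      (fun v _ hv => hmin (mem_sphere_zero_iff_norm.2 hv)) hmR hσA
      (by rw [hρmem σ hσ0]; exact hσρ)
      ((hδq _ hσA (by rw [hρmem σ hσ0]; exact hσδ)).trans hqm) hz
      (by rw [hzw]; exact hwp.trans_lt hpm)
    have hσz : σ < ‖z‖ := by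
      by_contra! hcon
      have := hδq z hz (hcon.trans_lt hσδ)
      rw [hzw] at this
      linarith
    have hzne : -z ≠ 0 := neg_ne_zero.2 (norm_pos_iff.1 hz0)
    -- This branch of the logarithm has imaginary part in `(0, 2π]`, matching the half-open
    -- rectangle.
    refine ⟨log (-z) + Real.pi * I, ⟨?_, ?_⟩, ?_⟩
    · simp only [mem_preimage, add_re, log_re, norm_neg, re_ofReal_mul, I_re, mul_zero, add_zero]
      exact ⟨Real.log_lt_log hσ0 hσz, ((Real.log_lt_iff_lt_exp hz0).2 hzρ).le⟩
    · simp only [mem_preimage, add_im, log_im, im_ofReal_mul, I_im, mul_one]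
      exact ⟨by linarith [neg_pi_lt_arg (-z)], by linarith [arg_le_pi (-z)]⟩
    · simp only [exp_add, exp_log hzne, exp_pi_mul_I]
      rw [← hzw]
      congr 1
      ring

theorem continuous_line_norm_sq (hh : IsHarmonicHomeo r R r' R' h) (hr : 0 < r) (hR : 0 < R)
    {t : ℝ} (ht : t ∈ Ioo (Real.log r) (Real.log R)) :
    Continuous fun θ : ℝ => ‖h (exp (t + θ * I))‖ ^ 2 :=
  (continuous_line (F := fun w => h (exp w)) (fun z hz => analyticAt_of_harmonicAt
    (hh.harmonicOnNhd_comp_exp hr hR z hz)) ht).norm.pow 2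

theorem sq_le_lineAverage_norm_sq (hh : IsHarmonicHomeo r R r' R' h) (hr : 0 < r) (hR : 0 < R)
    (hr' : 0 < r') {t : ℝ} (ht : t ∈ Ioo (Real.log r) (Real.log R)) :
    r' ^ 2 ≤ lineAverage (fun z => ‖h (exp z)‖ ^ 2) t :=
  le_lineAverage (hh.continuous_line_norm_sq hr hR ht) fun θ => pow_le_pow_left₀ hr'.le
    (hh.map_mem ((cexp_mem_annulus hr hR).2 (mem_strip_add_mul_I ht θ))).1.le 2

theorem lineAverage_norm_sq_le (hh : IsHarmonicHomeo r R r' R' h) (hr : 0 < r) (hR : 0 < R)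
    {t : ℝ} (ht : t ∈ Ioo (Real.log r) (Real.log R)) :
    lineAverage (fun z => ‖h (exp z)‖ ^ 2) t ≤ R' ^ 2 :=
  lineAverage_le (hh.continuous_line_norm_sq hr hR ht) fun θ => pow_le_pow_left₀ (norm_nonneg _)
    (hh.map_mem ((cexp_mem_annulus hr hR).2 (mem_strip_add_mul_I ht θ))).2.le 2

/-- The mean square of `h` over circles is nondecreasing. -/
theorem lineAverage_dot_dRe_nonneg (hh : IsHarmonicHomeo r R r' R' h) (hr : 0 < r) (hR : 0 < R)
    (hr' : 0 < r') {s : ℝ} (hs : s ∈ Ioo (Real.log r) (Real.log R)) :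
    0 ≤ lineAverage (fun z => dot (h (exp z)) (dRe (fun w => h (exp w)) z)) s := by
  set D := lineAverage (fun z => dot (h (exp z)) (dRe (fun w => h (exp w)) z)) s with hD
  by_contra! hneg
  -- For `t` to the left of the midpoint of `log r` and `s`, the tangent line with slope `2D` has
  -- risen by more than `η`, contradicting the boundary limit.
  set η := (s - Real.log r) * -D with hη
  have hη0 : 0 < η := mul_pos (sub_pos.2 hs.1) (neg_pos.2 hneg)
  have hq : r' < √(r' ^ 2 + η) := Real.lt_sqrt_of_sq_lt (by linarith)
  obtain ⟨δ, hδ, hδq⟩ := hh.exists_norm_lt hr hq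
  have hlog : Real.log r < Real.log (r + δ) := Real.log_lt_log hr (by linarith)
  obtain ⟨t, ht1, ht2⟩ := exists_between
    (lt_min hlog (show Real.log r < (Real.log r + s) / 2 by linarith [hs.1]))
  have htδ := ht2.trans_le (min_le_left _ _)
  have hts := ht2.trans_le (min_le_right _ _)
  have hts' : t < s := by linarith [hs.1]
  have ht : t ∈ Ioo (Real.log r) (Real.log R) := ⟨ht1, hts'.trans hs.2⟩
  have h1 := lineAverage_norm_sq_convex (hh.harmonicOnNhd_comp_exp hr hR) (periodic_comp_exp h)
    hs ht hts'
  have h2 := hh.sq_le_lineAverage_norm_sq hr hR hr' hs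
  have h3 : lineAverage (fun z => ‖h (exp z)‖ ^ 2) t ≤ r' ^ 2 + η := by
    refine lineAverage_le (hh.continuous_line_norm_sq hr hR ht) fun θ => ?_
    have h4 := hδq _ ((cexp_mem_annulus hr hR).2 (mem_strip_add_mul_I ht θ)) (by
      rw [norm_exp]
      simpa using (Real.lt_log_iff_exp_lt (by linarith)).1 htδ)
    rw [← Real.sq_sqrt (show 0 ≤ r' ^ 2 + η by positivity)]
    exact pow_le_pow_left₀ (norm_nonneg _) h4.le 2
  rw [← hD] at h1
  nlinarith

/-- Comparison of the mean square on a circle with data on a smaller circle. -/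
theorem sq_mul_cosh_sq_sub_le (hh : IsHarmonicHomeo r R r' R' h) (hr : 0 < r) (hR : 0 < R)
    (hr' : 0 < r') {s t : ℝ} (hs : s ∈ Ioo (Real.log r) (Real.log R))
    (ht : t ∈ Ioo (Real.log r) (Real.log R)) (hst : s < t) :
    r' ^ 2 * Real.cosh (t - s) ^ 2 - 2 * Real.sinh (t - s) * Real.cosh (t - s)
        * dot (lineCoeff (fun w => h (exp w)) 0 s) (lineCoeff (dRe fun w => h (exp w)) 0 s)
      - ‖lineCoeff (fun w => h (exp w)) 0 s‖ ^ 2 + ‖lineCoeff (fun w => h (exp w)) 0 t‖ ^ 2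
      ≤ lineAverage (fun z => ‖h (exp z)‖ ^ 2) t := by
  have h1 := lineAverage_norm_sq_ge (hh.harmonicOnNhd_comp_exp hr hR) (periodic_comp_exp h)
    hs ht hst
  have h2 := hh.sq_le_lineAverage_norm_sq hr hR hr' hs
  have h3 := mul_le_mul_of_nonneg_left (hh.sq_le_lineAverage_dot_dIm hr hR hr' hs)
    (sq_nonneg (Real.sinh (t - s)))
  have hsinh : 0 ≤ Real.sinh (t - s) := Real.sinh_nonneg_iff.2 (sub_nonneg.2 hst.le)
  have h4 : 0 ≤ 2 * Real.sinh (t - s) * Real.cosh (t - s)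
      * lineAverage (fun z => dot (h (exp z)) (dRe (fun w => h (exp w)) z)) s :=
    mul_nonneg (mul_nonneg (by positivity) (Real.cosh_pos _).le)
      (hh.lineAverage_dot_dRe_nonneg hr hR hr' hs)
  rw [Real.cosh_sq]
  linarith

theorem tendsto_cosh_sq (c t a : ℝ) :
    Tendsto (fun s : ℝ => c * Real.cosh (t - s) ^ 2) (𝓝[>] a) (𝓝 (c * Real.cosh (t - a) ^ 2)) := by
  have : Continuous fun s : ℝ => c * Real.cosh (t - s) ^ 2 :=
    continuous_const.mul ((Real.continuous_cosh.comp (by fun_prop)).pow 2)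
  exact (this.tendsto a).mono_left nhdsWithin_le_nhds

theorem sq_mul_cosh_sq_le_of_tendsto (hh : IsHarmonicHomeo r R r' R' h) (hr : 0 < r) (hR : 0 < R)
    (hr' : 0 < r') (hD : Tendsto (fun ρ : ℝ => Real.circleAverage h 0 ρ) (𝓝[>] r) (𝓝 0)) {t : ℝ}
    (ht : t ∈ Ioo (Real.log r) (Real.log R)) :
    r' ^ 2 * Real.cosh (t - Real.log r) ^ 2 ≤ lineAverage (fun z => ‖h (exp z)‖ ^ 2) t := by
  set k := lineCoeff (dRe fun w => h (exp w)) 0 t with hk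
  have hexp : Tendsto Real.exp (𝓝[>] (Real.log r)) (𝓝[>] r) := by
    refine tendsto_nhdsWithin_iff.2 ⟨?_, ?_⟩
    · have := (Real.continuous_exp.tendsto (Real.log r)).mono_left
        (nhdsWithin_le_nhds (s := Ioi (Real.log r)))
      rwa [Real.exp_log hr] at this
    · filter_upwards [self_mem_nhdsWithin] with s hs
      exact (Real.log_lt_iff_lt_exp hr).1 hs
  have hc0 : Tendsto (fun s => lineCoeff (fun w => h (exp w)) 0 s) (𝓝[>] (Real.log r)) (𝓝 0) := by
    simp only [lineCoeff_zero_eq_circleAverage]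
    exact hD.comp hexp
  have hdot : Tendsto (fun s => dot (lineCoeff (fun w => h (exp w)) 0 s) k)
      (𝓝[>] (Real.log r)) (𝓝 0) := by
    have hc : Continuous fun z : ℂ => dot z k := by unfold dot; fun_prop
    simpa [dot, Function.comp_def] using (hc.tendsto 0).comp hc0
  have hfac : Tendsto (fun s : ℝ => 2 * Real.sinh (t - s) * Real.cosh (t - s))
      (𝓝[>] (Real.log r))
      (𝓝 (2 * Real.sinh (t - Real.log r) * Real.cosh (t - Real.log r))) := by
    have : Continuous fun s : ℝ => 2 * Real.sinh (t - s) * Real.cosh (t - s) :=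
      (continuous_const.mul (Real.continuous_sinh.comp (by fun_prop))).mul
        (Real.continuous_cosh.comp (by fun_prop))
    exact (this.tendsto _).mono_left nhdsWithin_le_nhds
  have hlim := ((tendsto_cosh_sq (r' ^ 2) t (Real.log r)).sub (hfac.mul hdot)).sub
    (hc0.norm.pow 2)
  simp only [mul_zero, sub_zero, norm_zero, ne_eq, OfNat.ofNat_ne_zero, not_false_eq_true,
    zero_pow] at hlim
  refine le_of_tendsto hlim ?_
  filter_upwards [Ioo_mem_nhdsGT ht.1] with s hs
  have hs' : s ∈ Ioo (Real.log r) (Real.log R) := ⟨hs.1, hs.2.trans ht.2⟩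
  have h1 := hh.sq_mul_cosh_sq_sub_le hr hR hr' hs' ht hs.2
  -- The derivative of the zero mode does not depend on `s`, so its product with the vanishing
  -- average tends to zero.
  rw [← (lineCoeff_zero_eq (hh.harmonicOnNhd_comp_exp hr hR) (periodic_comp_exp h) hs' ht).1] at h1
  linarith [sq_nonneg ‖lineCoeff (fun w => h (exp w)) 0 t‖]

/-- A vanishing normal average on one circle makes the zero mode constant, so its corrections cancel
for every `s`. -/
theorem sq_mul_cosh_sq_le_of_circleAverage (hh : IsHarmonicHomeo r R r' R' h) (hr : 0 < r)
    (hR : 0 < R) (hr' : 0 < r') {ρ : ℝ} (hrρ : r < ρ) (hρR : ρ < R)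
    (hN : Real.circleAverage (normalDeriv h) 0 ρ = 0) {t : ℝ}
    (ht : t ∈ Ioo (Real.log r) (Real.log R)) :
    r' ^ 2 * Real.cosh (t - Real.log r) ^ 2 ≤ lineAverage (fun z => ‖h (exp z)‖ ^ 2) t := by
  have hρ0 : 0 < ρ := hr.trans hrρ
  have hρ : Real.log ρ ∈ Ioo (Real.log r) (Real.log R) :=
    ⟨Real.log_lt_log hr hrρ, Real.log_lt_log hρ0 hρR⟩
  have hk : lineCoeff (dRe fun w => h (exp w)) 0 (Real.log ρ) = 0 := by
    rw [lineCoeff_zero_dRe_eq_circleAverage hρ fun z hz => (analyticAt_of_harmonicAt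
      (hh.harmonic _ ((cexp_mem_annulus hr hR).2 hz))).differentiableAt, Real.exp_log hρ0, hN,
      mul_zero]
  refine le_of_tendsto (tendsto_cosh_sq (r' ^ 2) t (Real.log r)) ?_
  filter_upwards [Ioo_mem_nhdsGT ht.1] with s hs
  have hs' : s ∈ Ioo (Real.log r) (Real.log R) := ⟨hs.1, hs.2.trans ht.2⟩
  have h1 := hh.sq_mul_cosh_sq_sub_le hr hR hr' hs' ht hs.2
  have hHar := hh.harmonicOnNhd_comp_exp hr hR
  have hks := (lineCoeff_zero_eq hHar (periodic_comp_exp h) hρ hs').1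
  rw [hk] at hks
  rw [(lineCoeff_zero_eq hHar (periodic_comp_exp h) hs' ht).2, hks] at h1
  simpa [dot] using h1

/-- Let `t → log R` and use `U ≤ R'²`. -/
theorem cosh_log_div_le (hh : IsHarmonicHomeo r R r' R' h) (hr : 0 < r) (hrR : r < R)
    (hr' : 0 < r') (hrR' : r' < R')
    (hU : ∀ t ∈ Ioo (Real.log r) (Real.log R),
      r' ^ 2 * Real.cosh (t - Real.log r) ^ 2 ≤ lineAverage (fun z => ‖h (exp z)‖ ^ 2) t) :
    (1 / 2) * (R / r + r / R) ≤ R' / r' := by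
  have hR : 0 < R := hr.trans hrR
  have hcont : Continuous fun t : ℝ => r' ^ 2 * Real.cosh (t - Real.log r) ^ 2 :=
    continuous_const.mul ((Real.continuous_cosh.comp (by fun_prop)).pow 2)
  have h1 : r' ^ 2 * Real.cosh (Real.log R - Real.log r) ^ 2 ≤ R' ^ 2 := by
    refine le_of_tendsto ((hcont.tendsto (Real.log R)).mono_left
      (nhdsWithin_le_nhds (s := Iio (Real.log R)))) ?_
    filter_upwards [Ioo_mem_nhdsLT (Real.log_lt_log hr hrR)] with t ht
    exact (hU t ht).trans (hh.lineAverage_norm_sq_le hr hR ht)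
  rw [← mul_pow] at h1
  have h2 := le_of_sq_le_sq h1 (hr'.trans hrR').le
  rw [← Real.log_div hR.ne' hr.ne', Real.cosh_log (div_pos hR hr), inv_div] at h2
  rw [le_div_iff₀ hr']
  linarith

end IsHarmonicHomeo

end Nitsche

theorem mainTheorem4 (r R r' R' : ℝ) (hr : 0 < r) (hrR : r < R) (hr' : 0 < r') (hrR' : r' < R')
    (h : ℂ → ℂ) (hh : h ∈ Nitsche.ClassD r R r' R' ∨ h ∈ Nitsche.ClassN r R r' R') :
    (1 / 2) * (R / r + r / R) ≤ R' / r' := by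
  have hR : 0 < R := hr.trans hrR
  rcases hh with ⟨hh, hD⟩ | ⟨hh, ρ, hrρ, hρR, hN⟩
  · exact hh.cosh_log_div_le hr hrR hr' hrR' fun t ht =>
      hh.sq_mul_cosh_sq_le_of_tendsto hr hR hr' hD ht
  · exact hh.cosh_log_div_le hr hrR hr' hrR' fun t ht =>
      hh.sq_mul_cosh_sq_le_of_circleAverage hr hR hr' hrρ hρR hN ht
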